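/- Work over $\mathbb C$; a variety is a separated, reduced, not necessarily irreducible scheme of finite type, given by its closed points. Let $\bullet$ be either empty or $\mathrm f$, and put $\mathfrak{gl}_n^{\emptyset}=\mathfrak{gl}_n$ and $\mathfrak{gl}_n^{\mathrm f}=\mathfrak{gl}_n\times V_n$, $V_n=\mathbb C^n$, with the adjoint (and standard) action of $GL_n$. For $n,m\ge 0$, an object of $\mathrm{Hom}(n^\bullet,m^\bullet)$ is a pair $(Z,w)$: a variety $Z$ with an algebraic action of $GL_n\times GL_m$ and a function $w\in\mathbb C[\mathfrak{gl}_n^\bullet\times Z\times\mathfrak{gl}_m^\bullet]^{GL_n\times GL_m}$. *Composition.* For $(Z,w)\in\mathrm{Hom}(n^\bullet,m^\bullet)$ and $(Z',w')\in\mathrm{Hom}(m^\bullet,k^\bullet)$ the composition is $\bigl((Z\times\mathfrak{gl}_m^\bullet\times Z')/_{+}GL_m,\ w+w'\bigr)\in\mathrm{Hom}(n^\bullet,k^\bullet)$. Here $/_{+}GL_m$ is the GIT quotient: the good quotient (a surjective invariant morphism of varieties for which regular functions on open sets are the invariant regular functions on their preimages, images of closed invariant sets are closed, and disjoint closed invariant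 sets have disjoint images) of the semistable locus, which consists of the points at which some regular function $s$ with $s(b\cdot x)=\det(b)^r s(x)$ for all $b\in GL_m$, for some $r>0$, does not vanish. The quotient carries the induced action of $GL_n\times GL_k$ and the induced potential. *Knörrer equivalence.* $\sim$ is the equivalence relation on objects of $\mathrm{Hom}(n^\bullet,m^\bullet)$ generated by $(Z,W|_Z)\sim(V\times_Z V^*,\,W+Q_V)$, where $V\to Z$ is a $GL_n\times GL_m$-equivariant vector bundle of finite rank, $Q_V$ is the canonical pairing of $V$ and $V^*$, $W$ is an invariant regular function on $\mathfrak{gl}_n^\bullet\times V\times\mathfrak{gl}_m^\bullet$, and $W|_Z$ is its restriction to the zero section; the right side may be replaced by any $(Z',w')$ with an equivariant isomorphism $\mathfrak{gl}_n^\bullet\times Z'\times\mathfrak{gl}_m^\bullet\cong\mathfrak{gl}_n^\bullet\times(V\times_ZV^*)\times\mathfrak{gl}_m^\bullet$ over $\mathfrak{gl}_n^\bullet\times\mathfrak{gl}_m^\bullet$ that carries $w'$ to $W+Q_V$. *Identity objects.* Let $T^*GL_n=GL_n\times\mathfrak{gl}_n\ni(g,\phi)$ and $$L_{\mathrm{id}}^n=\bigl(T^*GL_n,\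 \mathrm{Tr}\,\phi(X-\mathrm{Ad}_gX')\bigr)\in\mathrm{Hom}(n,n),$$ $$L_{\mathrm{id}}^n=\bigl(T^*GL_n\times V_n^*,\ \mathrm{Tr}\,\phi(X-\mathrm{Ad}_gX')+w\cdot(v-gv')\bigr)\in\mathrm{Hom}(n^{\mathrm f},n^{\mathrm f}),$$ with $(X,v),(X',v')\in\mathfrak{gl}_n\times V_n$, $w\in V_n^*$, and the action $(a,b)\cdot(g,\phi,w)=(agb^{-1},\mathrm{Ad}_a\phi,wa^{-1})$. **Proposition.** For all $n,m\ge0$ and every $L\in\mathrm{Hom}(n^\bullet,m^\bullet)$, in both the unframed and the framed case, the composition $L\circ L_{\mathrm{id}}^n$ (of $L_{\mathrm{id}}^n$ with $L$ along $\mathfrak{gl}_n^\bullet$) and the composition $L_{\mathrm{id}}^m\circ L$ (of $L$ with $L_{\mathrm{id}}^m$ along $\mathfrak{gl}_m^\bullet$) exist, and $$L_{\mathrm{id}}^m\circ L\sim L,\qquad L\circ L_{\mathrm{id}}^n\sim L .$$ -/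

import Mathlib

namespace KRS

open scoped Topology

noncomputable section

/-! ### Spaces with functions and algebraic varieties over `ℂ`

Varieties are taken in the classical sense: sets of (closed) points with the Zariski topology and
a sheaf of `ℂ`-valued functions, locally isomorphic to Zariski closed subsets of affine space. -/

/-- A space with functions: a topological space together with a local notion of regularity
of complex valued functions at points.  The ring of functions on an open set `U` consists of the
functions which are regular at each point of `U`; only the values near the point matter. -/
structure Space where
  carrier : Type
  top : TopologicalSpace carrier
  RegAt : (carrier → ℂ) → carrier → Prop
  congr' : ∀ (f g : carrier → ℂ) (x : carrier) (U : Set carrier), IsOpen[top] U → x ∈ U →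
    (∀ y ∈ U, f y = g y) → RegAt f x → RegAt g x

/-- `f` is a regular function on the whole of `X`, i.e. an element of `ℂ[X]`. -/
def Space.Regular (X : Space) (f : X.carrier → ℂ) : Prop := ∀ x, X.RegAt f x

/-- `f` is regular on the subset `U`. -/
def Space.RegularOn (X : Space) (U : Set X.carrier) (f : X.carrier → ℂ) : Prop :=
  ∀ x ∈ U, X.RegAt f x

/-- Morphisms: continuous maps which pull back regular functions to regular functions. -/
structure IsMorphism (X Y : Space) (φ : X.carrier → Y.carrier) : Prop where
  continuous : ∀ U : Set Y.carrier, IsOpen[Y.top] U → IsOpen[X.top] (φ ⁻¹' U)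
  regular : ∀ (f : Y.carrier → ℂ) (x : X.carrier), Y.RegAt f (φ x) → X.RegAt (fun y => f (φ y)) x

/-- Isomorphisms of spaces with functions. -/
def IsIso {X Y : Space} (φ : X.carrier ≃ Y.carrier) : Prop :=
  IsMorphism X Y φ ∧ IsMorphism Y X φ.symm

/-- The Zariski topology of the affine space `ℂ^σ`. -/
@[reducible] def zariski (σ : Type) : TopologicalSpace (σ → ℂ) :=
  TopologicalSpace.generateFrom
    {U | ∃ p : MvPolynomial σ ℂ, U = {x | MvPolynomial.eval x p ≠ 0}}

/-- The space with functions on a set `X` with coordinates `ι : X → ℂ^σ`: the topology is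
the Zariski topology, and regular functions are locally quotients of polynomials in the
coordinates.  For injective `ι` this is the subset `ι(X)` of affine space. -/
abbrev Space.ofCoords {X σ : Type} (ι : X → σ → ℂ) : Space where
  carrier := X
  top := (zariski σ).induced ι
  RegAt f x := ∃ U : Set X, IsOpen[(zariski σ).induced ι] U ∧ x ∈ U ∧
    ∃ p q : MvPolynomial σ ℂ, ∀ y ∈ U,
      MvPolynomial.eval (ι y) q ≠ 0 ∧ f y = MvPolynomial.eval (ι y) p / MvPolynomial.eval (ι y) q
  congr' := by
    rintro f g x U hU hx h ⟨V, hV, hxV, p, q, hpq⟩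
    refine ⟨U ∩ V, @IsOpen.inter _ ((zariski σ).induced ι) _ _ hU hV, ⟨hx, hxV⟩, p, q, ?_⟩
    rintro y ⟨hyU, hyV⟩
    exact ⟨(hpq y hyV).1, by rw [← h y hyU]; exact (hpq y hyV).2⟩

open Classical in
/-- The open subspace on an open subset `U`. -/
abbrev Space.restrict (X : Space) (U : Set X.carrier) : Space where
  carrier := U
  top := X.top.induced Subtype.val
  RegAt f x := X.RegAt (fun y => if h : y ∈ U then f ⟨y, h⟩ else 0) x.1
  congr' := by
    rintro f g x V ⟨W, hW, rfl⟩ hx h hf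
    refine X.congr' _ _ _ W hW hx ?_ hf
    intro y hy
    by_cases hyU : y ∈ U
    · simp only [hyU, dif_pos]
      exact h ⟨y, hyU⟩ hy
    · simp only [hyU, dif_neg, not_false_eq_true]

/-- `h` is on `U × V` a finite sum of products `f(x) g(y)`, with `f` regular on `U` and
`g` regular on `V`. -/
def IsTensorOn (X Y : Space) (U : Set X.carrier) (V : Set Y.carrier)
    (h : X.carrier × Y.carrier → ℂ) : Prop :=
  ∃ (k : ℕ) (f : Fin k → X.carrier → ℂ) (g : Fin k → Y.carrier → ℂ),
    (∀ i, X.RegularOn U (f i)) ∧ (∀ i, Y.RegularOn V (g i)) ∧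
    ∀ x ∈ U, ∀ y ∈ V, h (x, y) = ∑ i, f i x * g i y

/-- The Zariski topology of a product: a basis is given by the sets on which a function from
`𝒪(U) ⊗ 𝒪(V)` does not vanish. -/
@[reducible] def prodTop (X Y : Space) : TopologicalSpace (X.carrier × Y.carrier) :=
  TopologicalSpace.generateFrom
    {W | ∃ U V h, IsOpen[X.top] U ∧ IsOpen[Y.top] V ∧ IsTensorOn X Y U V h ∧
      W = {p | p.1 ∈ U ∧ p.2 ∈ V ∧ h p ≠ 0}}

/-- The product of two varieties (not the product topology): regular functions are locally
quotients of elements of `𝒪(U) ⊗ 𝒪(V)`. -/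
abbrev Space.prod (X Y : Space) : Space where
  carrier := X.carrier × Y.carrier
  top := prodTop X Y
  RegAt f x := ∃ (U : Set X.carrier) (V : Set Y.carrier) (W : Set (X.carrier × Y.carrier))
    (p q : X.carrier × Y.carrier → ℂ),
    IsOpen[X.top] U ∧ IsOpen[Y.top] V ∧ IsOpen[prodTop X Y] W ∧ x ∈ W ∧
    IsTensorOn X Y U V p ∧ IsTensorOn X Y U V q ∧
    ∀ y ∈ W, y.1 ∈ U ∧ y.2 ∈ V ∧ q y ≠ 0 ∧ f y = p y / q y
  congr' := by
    rintro f g x U' hU' hx h ⟨U, V, W, p, q, hU, hV, hW, hxW, hp, hq, hy⟩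
    refine ⟨U, V, U' ∩ W, p, q, hU, hV, @IsOpen.inter _ (prodTop X Y) _ _ hU' hW, ⟨hx, hxW⟩,
      hp, hq, ?_⟩
    rintro y ⟨hyU, hyW⟩
    obtain ⟨h1, h2, h3, h4⟩ := hy y hyW
    exact ⟨h1, h2, h3, by rw [← h y hyU]; exact h4⟩

/-- The space obtained by gluing parametrizations `d i : M i → E`: a set is open if its preimages
are, and a function is regular at a point if it is regular in a parametrization. -/
abbrev Space.glue {E I : Type} (M : I → Space) (d : ∀ i, (M i).carrier → E) : Space where
  carrier := E
  top := ⨆ i, (M i).top.coinduced (d i)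
  RegAt f x := ∃ i, ∃ y : (M i).carrier, d i y = x ∧ (M i).RegAt (fun t => f (d i t)) y
  congr' := by
    rintro f g x U hU hx h ⟨i, y, rfl, hf⟩
    refine ⟨i, y, rfl, (M i).congr' _ _ y (d i ⁻¹' U) ?_ hx (fun t ht => h _ ht) hf⟩
    exact isOpen_coinduced.1 ((isOpen_iSup_iff.1 hU) i)

/-- `X` is isomorphic to a Zariski closed subset of some affine space `ℂ^σ`, `σ` finite. -/
def Space.IsAffine (X : Space) : Prop :=
  ∃ (σ : Type) (_ : Finite σ) (ι : X.carrier → σ → ℂ), Function.Injective ι ∧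
    IsClosed[zariski σ] (Set.range ι) ∧ X.top = (zariski σ).induced ι ∧
    ∀ f x, X.RegAt f x ↔ (Space.ofCoords ι).RegAt f x

/-- Algebraic varieties over `ℂ` (not necessarily irreducible): finitely many affine charts,
and the diagonal is closed. -/
structure Space.IsVariety (X : Space) : Prop where
  charts : ∃ (k : ℕ) (U : Fin k → Set X.carrier), (∀ i, IsOpen[X.top] (U i)) ∧
    (⋃ i, U i) = Set.univ ∧ ∀ i, (X.restrict (U i)).IsAffine
  separated : IsClosed[(X.prod X).top] {p : X.carrier × X.carrier | p.1 = p.2}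

/-! ### The groups `GL_n` and the spaces `𝔤𝔩_n`, `𝔤𝔩_n × V_n` -/

abbrev GLn (n : ℕ) : Type := Matrix.GeneralLinearGroup (Fin n) ℂ

abbrev Mat (n : ℕ) : Type := Matrix (Fin n) (Fin n) ℂ

/-- The entries of `g` and of `g⁻¹`: the closed embedding `GL_n → ℂ^{2n²}`. -/
def glnCoords (n : ℕ) (g : GLn n) : (Fin n × Fin n) ⊕ (Fin n × Fin n) → ℂ :=
  Sum.elim (fun e => g.1 e.1 e.2) (fun e => (g⁻¹).1 e.1 e.2)

/-- The algebraic group `GL_n × GL_m`. -/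
abbrev groupSpace (n m : ℕ) : Space :=
  Space.ofCoords (fun g : GLn n × GLn m => Sum.elim (glnCoords n g.1) (glnCoords m g.2))

/-- The index `•`, which is either empty or `f`. -/
inductive Framing where
  | unframed
  | framed

def matCoords (n : ℕ) (X : Mat n) : Fin n × Fin n → ℂ := fun e => X e.1 e.2

/-- The set `𝔤𝔩_n^•`: matrices, or pairs of a matrix and a vector. -/
abbrev GlType : Framing → ℕ → Type
  | .unframed, n => Mat n
  | .framed, n => Mat n × (Fin n → ℂ)

/-- The index set of the standard linear coordinates on `𝔤𝔩_n^•`. -/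
abbrev GlIndex : Framing → ℕ → Type
  | .unframed, n => Fin n × Fin n
  | .framed, n => (Fin n × Fin n) ⊕ Fin n

/-- The standard linear coordinates on `𝔤𝔩_n^•`. -/
def glCoords : (fr : Framing) → (n : ℕ) → GlType fr n → GlIndex fr n → ℂ
  | .unframed, n => fun X => matCoords n X
  | .framed, n => fun x => Sum.elim (matCoords n x.1) x.2

/-- The affine space `𝔤𝔩_n^•`, which is `𝔤𝔩_n` or `𝔤𝔩_n × V_n`. -/
abbrev glSpace (fr : Framing) (n : ℕ) : Space := Space.ofCoords (glCoords fr n)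

/-- The action of `GL_n` on `𝔤𝔩_n^•`: adjoint on matrices, standard on vectors. -/
def glAct : (fr : Framing) → (n : ℕ) → GLn n → GlType fr n → GlType fr n
  | .unframed, _, a => fun X => a.1 * X * (a⁻¹).1
  | .framed, _, a => fun x => (a.1 * x.1 * (a⁻¹).1, a.1.mulVec x.2)

/-! ### The objects of `Hom(n^•, m^•)` -/

/-- An object `(Z, w)` of `Hom(n^•, m^•)`: a variety `Z` with an algebraic action of
`GL_n × GL_m` and an invariant regular function `w` on `𝔤𝔩_n^• × Z × 𝔤𝔩_m^•`. -/
structure HomObj (fr : Framing) (n m : ℕ) where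
  Z : Space
  isVariety : Z.IsVariety
  act : MulAction (GLn n × GLn m) Z.carrier
  act_algebraic : IsMorphism ((groupSpace n m).prod Z) Z (fun p => p.1 • p.2)
  w : GlType fr n → Z.carrier → GlType fr m → ℂ
  w_regular : (((glSpace fr n).prod Z).prod (glSpace fr m)).Regular (fun p => w p.1.1 p.1.2 p.2)
  w_invariant : ∀ (a : GLn n) (b : GLn m) (x : GlType fr n) (z : Z.carrier) (y : GlType fr m),
    w (glAct fr n a x) ((a, b) • z) (glAct fr m b y) = w x z y

attribute [instance] HomObj.act

/-! ### Composition by GIT quotients -/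

/-- The points of `X` which are semistable with respect to the character `det`: some
`det^k`-semi-invariant regular function, `k > 0`, does not vanish there. -/
def semistable (X : Space) {m : ℕ} (act : GLn m → X.carrier → X.carrier) : Set X.carrier :=
  {x | ∃ (k : ℕ) (s : X.carrier → ℂ), 0 < k ∧ X.Regular s ∧
    (∀ b y, s (act b y) = b.1.det ^ k * s y) ∧ s x ≠ 0}

/-- `π : X → Q` is a good quotient of `X` by the orbit equivalence relation `r`: it is a
surjective invariant morphism, regular functions on an open set `U` of `Q` are the invariant
regular functions on its preimage, images of closed invariant sets are closed, and disjoint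
closed invariant sets have disjoint images. -/
structure IsGoodQuotient (X Q : Space) (r : X.carrier → X.carrier → Prop)
    (π : X.carrier → Q.carrier) : Prop where
  morphism : IsMorphism X Q π
  surjective : Function.Surjective π
  invariant : ∀ x y, r x y → π x = π y
  functions : ∀ (U : Set Q.carrier) (f : X.carrier → ℂ), IsOpen[Q.top] U →
    X.RegularOn (π ⁻¹' U) f → (∀ x ∈ π ⁻¹' U, ∀ y, r x y → f x = f y) →
    ∃ f' : Q.carrier → ℂ, Q.RegularOn U f' ∧ ∀ x ∈ π ⁻¹' U, f x = f' (π x)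
  closed : ∀ A : Set X.carrier, IsClosed[X.top] A → (∀ x ∈ A, ∀ y, r x y → y ∈ A) →
    IsClosed[Q.top] (π '' A)
  disjoint : ∀ A B : Set X.carrier, IsClosed[X.top] A → IsClosed[X.top] B →
    (∀ x ∈ A, ∀ y, r x y → y ∈ A) → (∀ x ∈ B, ∀ y, r x y → y ∈ B) →
    Disjoint A B → Disjoint (π '' A) (π '' B)

section Composition

variable {fr : Framing} {n m k : ℕ}

/-- The variety `Z × 𝔤𝔩_m^• × Z'`. -/
abbrev compSpace (L : HomObj fr n m) (L' : HomObj fr m k) : Space :=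
  (L.Z.prod (glSpace fr m)).prod L'.Z

/-- The action of the middle group `GL_m` on `Z × 𝔤𝔩_m^• × Z'`. -/
def midAct (L : HomObj fr n m) (L' : HomObj fr m k) (b : GLn m)
    (p : (compSpace L L').carrier) : (compSpace L L').carrier :=
  ((((1 : GLn n), b) • p.1.1, glAct fr m b p.1.2), (b, (1 : GLn k)) • p.2)

/-- The action of the outer groups `GL_n × GL_k` on `Z × 𝔤𝔩_m^• × Z'`. -/
def outAct (L : HomObj fr n m) (L' : HomObj fr m k) (a : GLn n) (c : GLn k)
    (p : (compSpace L L').carrier) : (compSpace L L').carrier :=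
  (((a, (1 : GLn m)) • p.1.1, p.1.2), ((1 : GLn m), c) • p.2)

/-- `K = (Z'', w'')` is the composition of `L = (Z, w)` and `L' = (Z', w')`, that is
`(Z × 𝔤𝔩_m^• × Z' /₊ GL_m, w + w')`: the variety `Z''` is the quotient of the
semistable locus by `GL_m`, with the induced action of `GL_n × GL_k` and the induced potential. -/
def IsComposition (L : HomObj fr n m) (L' : HomObj fr m k) (K : HomObj fr n k) : Prop :=
  ∃ π : semistable (compSpace L L') (midAct L L') → K.Z.carrier,
    IsGoodQuotient ((compSpace L L').restrict (semistable (compSpace L L') (midAct L L'))) K.Z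
      (fun x y => ∃ b : GLn m, y.1 = midAct L L' b x.1) π ∧
    (∀ (a : GLn n) (c : GLn k) (x y : semistable (compSpace L L') (midAct L L')),
      y.1 = outAct L L' a c x.1 → π y = (a, c) • π x) ∧
    ∀ (X : GlType fr n) (x : semistable (compSpace L L') (midAct L L')) (Y : GlType fr k),
      K.w X (π x) Y = L.w X x.1.1.1 x.1.1.2 + L'.w x.1.1.2 x.1.2 Y

end Composition

/-! ### Equivariant vector bundles and Knörrer equivalence -/

/-- An algebraic vector bundle of finite rank over `Z`, given by its fibres and by local
trivializations whose transition matrices are regular. -/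
structure VectorBundle (Z : Space) where
  fib : Z.carrier → Type
  [addCommGroup : ∀ z, AddCommGroup (fib z)]
  [module : ∀ z, Module ℂ (fib z)]
  I : Type
  U : I → Set Z.carrier
  isOpen_U : ∀ i, IsOpen[Z.top] (U i)
  cover : ∀ z, ∃ i, z ∈ U i
  rank : I → ℕ
  triv : ∀ (i : I) (z : U i), fib z.1 ≃ₗ[ℂ] (Fin (rank i) → ℂ)
  transition : ∀ (i j : I) (v : Fin (rank i) → ℂ) (e : Fin (rank j)),
    (Z.restrict (U i ∩ U j)).Regular
      (fun z => triv j ⟨z.1, z.2.2⟩ ((triv i ⟨z.1, z.2.1⟩).symm v) e)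

attribute [instance] VectorBundle.addCommGroup VectorBundle.module

/-- The affine space `ℂ^r`. -/
abbrev affineSpace (r : ℕ) : Space := Space.ofCoords (fun c : Fin r → ℂ => c)

/-- The total space of `V`, glued from the products `U_i × ℂ^r`. -/
abbrev VectorBundle.total {Z : Space} (V : VectorBundle Z) : Space :=
  Space.glue (E := Σ z, V.fib z)
    (fun i => (Z.restrict (V.U i)).prod (affineSpace (V.rank i)))
    (fun i p => ⟨p.1.1, (V.triv i p.1).symm p.2⟩)

/-- The total space of `V ×_Z V^*`, glued from the products `U_i × ℂ^r × ℂ^r`; the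
coordinates on the dual fibres are dual to those on the fibres. -/
abbrev VectorBundle.double {Z : Space} (V : VectorBundle Z) : Space :=
  Space.glue (E := Σ z, V.fib z × Module.Dual ℂ (V.fib z))
    (fun i => ((Z.restrict (V.U i)).prod (affineSpace (V.rank i))).prod (affineSpace (V.rank i)))
    (fun i p => ⟨p.1.1.1, (V.triv i p.1.1).symm p.1.2,
      (∑ e, p.2 e • LinearMap.proj e : (Fin (V.rank i) → ℂ) →ₗ[ℂ] ℂ).comp
        (V.triv i p.1.1).toLinearMap⟩)

/-- A `GL_n × GL_m`-equivariant vector bundle over the variety `Z` of `L = (Z, w)`. -/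
structure EquivBundle {fr : Framing} {n m : ℕ} (L : HomObj fr n m) extends VectorBundle L.Z where
  act : ∀ (g : GLn n × GLn m) (z : L.Z.carrier), fib z ≃ₗ[ℂ] fib (g • z)
  act_one : ∀ (z : L.Z.carrier) (v : fib z),
    (⟨(1 : GLn n × GLn m) • z, act 1 z v⟩ : Σ z, fib z) = ⟨z, v⟩
  act_mul : ∀ (g h : GLn n × GLn m) (z : L.Z.carrier) (v : fib z),
    (⟨(g * h) • z, act (g * h) z v⟩ : Σ z, fib z) = ⟨g • h • z, act g (h • z) (act h z v)⟩
  act_algebraic : IsMorphism ((groupSpace n m).prod toVectorBundle.total) toVectorBundle.total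
    (fun p => ⟨p.1 • p.2.1, act p.1 p.2.1 p.2.2⟩)

section Knorrer

variable {fr : Framing} {n m : ℕ}

/-- The action on `V`. -/
def EquivBundle.actTotal {L : HomObj fr n m} (V : EquivBundle L) (g : GLn n × GLn m)
    (p : V.total.carrier) : V.total.carrier :=
  ⟨g • p.1, V.act g p.1 p.2⟩

/-- The action on `V ×_Z V^*`, contragredient on the dual fibres. -/
def EquivBundle.actDouble {L : HomObj fr n m} (V : EquivBundle L) (g : GLn n × GLn m)
    (p : V.double.carrier) : V.double.carrier :=
  ⟨g • p.1, V.act g p.1 p.2.1, p.2.2.comp (V.act g p.1).symm.toLinearMap⟩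

/-- An elementary Knörrer equivalence between `L = (Z, W|_Z)` and
`L' ≅ (V ×_Z V^*, W + Q_V)`.  Here `V` is an equivariant vector bundle over `Z`, `W` is an
invariant regular function on `𝔤𝔩_n^• × V × 𝔤𝔩_m^•` which restricts to the potential of
`L` on the zero section, `Q_V` is the canonical pairing, and the identification `Φ` is an
equivariant isomorphism of the spaces which carry the potentials, over `𝔤𝔩_n^• × 𝔤𝔩_m^•`. -/
def KnorrerStep (L L' : HomObj fr n m) : Prop :=
  ∃ (V : EquivBundle L) (W : GlType fr n → V.total.carrier → GlType fr m → ℂ)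
    (Φ : (((glSpace fr n).prod L'.Z).prod (glSpace fr m)).carrier ≃
      (((glSpace fr n).prod V.double).prod (glSpace fr m)).carrier),
    (((glSpace fr n).prod V.total).prod (glSpace fr m)).Regular (fun p => W p.1.1 p.1.2 p.2) ∧
    (∀ a b x v y, W (glAct fr n a x) (V.actTotal (a, b) v) (glAct fr m b y) = W x v y) ∧
    (∀ x z y, W x ⟨z, 0⟩ y = L.w x z y) ∧
    IsIso (X := ((glSpace fr n).prod L'.Z).prod (glSpace fr m))
      (Y := ((glSpace fr n).prod V.double).prod (glSpace fr m)) Φ ∧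
    (∀ x z y, (Φ ((x, z), y)).1.1 = x ∧ (Φ ((x, z), y)).2 = y) ∧
    (∀ a b x z y, (Φ ((glAct fr n a x, (a, b) • z), glAct fr m b y)).1.2 =
      V.actDouble (a, b) (Φ ((x, z), y)).1.2) ∧
    ∀ x z y, L'.w x z y =
      W x ⟨(Φ ((x, z), y)).1.2.1, (Φ ((x, z), y)).1.2.2.1⟩ y +
        (Φ ((x, z), y)).1.2.2.2 (Φ ((x, z), y)).1.2.2.1

/-- Knörrer equivalence `∼`: the equivalence relation generated by the elementary ones. -/
def KnorrerEquiv (L L' : HomObj fr n m) : Prop := Relation.EqvGen KnorrerStep L L'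

end Knorrer

/-! ### Helper facts on spaces with coordinates -/

section Coordinates

variable {A X τ σ : Type}

theorem isOpen_univ' (X : Space) : IsOpen[X.top] (Set.univ : Set X.carrier) :=
  @isOpen_univ _ X.top

theorem ofCoords_regular {ι : X → σ → ℂ} (p : MvPolynomial σ ℂ) :
    (Space.ofCoords ι).Regular (fun x => MvPolynomial.eval (ι x) p) := fun x =>
  ⟨Set.univ, isOpen_univ' (Space.ofCoords ι), Set.mem_univ x, p, 1, fun y _ => by simp⟩

theorem ofCoords_isOpen {ι : X → σ → ℂ} (p : MvPolynomial σ ℂ) :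
    IsOpen[(Space.ofCoords ι).top] {x | MvPolynomial.eval (ι x) p ≠ 0} :=
  ⟨{x | MvPolynomial.eval x p ≠ 0}, TopologicalSpace.isOpen_generateFrom_of_mem ⟨p, rfl⟩, rfl⟩

theorem isClosed_zeros {J : Type} (P : J → MvPolynomial σ ℂ) :
    IsClosed[zariski σ] {x | ∀ j, MvPolynomial.eval x (P j) = 0} := by
  let := zariski σ
  rw [Set.ofPred_forall]
  refine isClosed_iInter fun j => ⟨?_⟩
  exact TopologicalSpace.isOpen_generateFrom_of_mem ⟨P j, rfl⟩

theorem ofCoords_isVariety [Finite σ] {ι : X → σ → ℂ} (hι : Function.Injective ι)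
    (hc : IsClosed[zariski σ] (Set.range ι)) : (Space.ofCoords ι).IsVariety where
  charts := by
    refine ⟨1, fun _ => Set.univ, fun _ => isOpen_univ' (Space.ofCoords ι), Set.iUnion_const _, fun _ =>
      ⟨σ, inferInstance, fun x => ι x.1, hι.comp Subtype.val_injective, ?_, ?_, ?_⟩⟩
    · convert hc using 1
      ext y
      simp
    · exact induced_compose
    · intro f x
      constructor
      · rintro ⟨U, hU, hx, p, q, h⟩
        obtain ⟨W, hW, rfl⟩ := hU
        refine ⟨Subtype.val ⁻¹' (ι ⁻¹' W), ⟨W, hW, rfl⟩, hx, p, q, fun y hy => ?_⟩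
        have := h y.1 hy
        simpa using this
      · rintro ⟨U, hU, hx, p, q, h⟩
        obtain ⟨W, hW, rfl⟩ := hU
        refine ⟨ι ⁻¹' W, ⟨W, hW, rfl⟩, hx, p, q, fun y hy => ?_⟩
        have := h ⟨y, Set.mem_univ y⟩ hy
        simpa using this
  separated := by
    let := prodTop (Space.ofCoords ι) (Space.ofCoords ι)
    have : {p : X × X | p.1 = p.2} = ⋂ i, {p : X × X | ι p.1 i = ι p.2 i} := by
      ext p
      simp only [Set.mem_ofPred_eq, Set.mem_iInter]
      exact ⟨fun h i => by rw [h], fun h => hι (funext h)⟩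
    change IsClosed {p : X × X | p.1 = p.2}
    rw [this]
    refine isClosed_iInter fun i => ⟨?_⟩
    refine TopologicalSpace.isOpen_generateFrom_of_mem
      ⟨Set.univ, Set.univ, fun p => ι p.1 i - ι p.2 i, isOpen_univ' _, isOpen_univ' _,
        ⟨2, ![fun x => ι x i, fun _ => 1], ![fun _ => 1, fun x => - ι x i], ?_, ?_, ?_⟩, ?_⟩
    · intro j x _
      fin_cases j
      · simpa using ofCoords_regular (ι := ι) (MvPolynomial.X i) x
      · simpa using ofCoords_regular (ι := ι) 1 x
    · intro j x _
      fin_cases j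
      · simpa using ofCoords_regular (ι := ι) 1 x
      · simpa using ofCoords_regular (ι := ι) (-MvPolynomial.X i) x
    · intro x _ y _
      simp [Fin.sum_univ_two, sub_eq_add_neg]
    · ext p
      simp [sub_eq_zero]

theorem poly_tensor (P : MvPolynomial (τ ⊕ σ) ℂ) :
    ∃ (k : ℕ) (p : Fin k → MvPolynomial τ ℂ) (q : Fin k → MvPolynomial σ ℂ),
      ∀ (a : τ → ℂ) (x : σ → ℂ), MvPolynomial.eval (Sum.elim a x) P =
        ∑ i, MvPolynomial.eval a (p i) * MvPolynomial.eval x (q i) := by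
  induction P using MvPolynomial.induction_on with
  | C c => exact ⟨1, fun _ => MvPolynomial.C c, fun _ => 1, fun a x => by simp⟩
  | add P Q hP hQ =>
    obtain ⟨k, p, q, h⟩ := hP
    obtain ⟨k', p', q', h'⟩ := hQ
    exact ⟨k + k', Fin.append p p', Fin.append q q', fun a x => by
      simp [h, h', Fin.sum_univ_add]⟩
  | mul_X P i hP =>
    obtain ⟨k, p, q, h⟩ := hP
    cases i with
    | inl i =>
      exact ⟨k, fun j => p j * MvPolynomial.X i, q, fun a x => by
        simp only [map_mul, h, MvPolynomial.eval_X, Sum.elim_inl, Finset.sum_mul]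
        exact Finset.sum_congr rfl fun _ _ => by ring⟩
    | inr i =>
      exact ⟨k, p, fun j => q j * MvPolynomial.X i, fun a x => by
        simp only [map_mul, h, MvPolynomial.eval_X, Sum.elim_inr, Finset.sum_mul]
        exact Finset.sum_congr rfl fun _ _ => by ring⟩

theorem isTensorOn_poly (κ : A → τ → ℂ) (ι : X → σ → ℂ) (P : MvPolynomial (τ ⊕ σ) ℂ) :
    IsTensorOn (Space.ofCoords κ) (Space.ofCoords ι) Set.univ Set.univ
      (fun p => MvPolynomial.eval (Sum.elim (κ p.1) (ι p.2)) P) := by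
  obtain ⟨k, p, q, h⟩ := poly_tensor P
  exact ⟨k, fun i a => MvPolynomial.eval (κ a) (p i), fun i x => MvPolynomial.eval (ι x) (q i),
    fun i a _ => ofCoords_regular (p i) a, fun i x _ => ofCoords_regular (q i) x,
    fun a _ x _ => h _ _⟩

theorem prod_regular {X Y : Space} {h : X.carrier × Y.carrier → ℂ}
    (hh : IsTensorOn X Y Set.univ Set.univ h)
    (h1 : IsTensorOn X Y Set.univ Set.univ (fun _ => 1)) : (X.prod Y).Regular h := fun x =>
  ⟨Set.univ, Set.univ, Set.univ, h, fun _ => 1, isOpen_univ' X, isOpen_univ' Y,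
    isOpen_univ' (X.prod Y), Set.mem_univ x, hh, h1, fun y _ => by simp⟩

/-- `F` is a polynomial in the coordinates of its two arguments. -/
def IsPoly (κ : A → τ → ℂ) (ι : X → σ → ℂ) (F : A → X → ℂ) : Prop :=
  ∃ P : MvPolynomial (τ ⊕ σ) ℂ, ∀ a x, F a x = MvPolynomial.eval (Sum.elim (κ a) (ι x)) P

theorem IsPoly.left {κ : A → τ → ℂ} {ι : X → σ → ℂ} (i : τ) :
    IsPoly κ ι (fun a _ => κ a i) := ⟨MvPolynomial.X (Sum.inl i), fun a x => by simp⟩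

theorem IsPoly.right {κ : A → τ → ℂ} {ι : X → σ → ℂ} (i : σ) :
    IsPoly κ ι (fun _ x => ι x i) := ⟨MvPolynomial.X (Sum.inr i), fun a x => by simp⟩

theorem IsPoly.mul {κ : A → τ → ℂ} {ι : X → σ → ℂ} {F G : A → X → ℂ}
    (hF : IsPoly κ ι F) (hG : IsPoly κ ι G) : IsPoly κ ι (fun a x => F a x * G a x) := by
  obtain ⟨P, hP⟩ := hF
  obtain ⟨Q, hQ⟩ := hG
  exact ⟨P * Q, fun a x => by simp [hP, hQ]⟩

theorem IsPoly.sum {κ : A → τ → ℂ} {ι : X → σ → ℂ} {J : Type} [Fintype J] {F : J → A → X → ℂ}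
    (hF : ∀ j, IsPoly κ ι (F j)) : IsPoly κ ι (fun a x => ∑ j, F j a x) := by
  choose P hP using hF
  exact ⟨∑ j, P j, fun a x => by simp [hP]⟩

theorem IsPoly.add {κ : A → τ → ℂ} {ι : X → σ → ℂ} {F G : A → X → ℂ}
    (hF : IsPoly κ ι F) (hG : IsPoly κ ι G) : IsPoly κ ι (fun a x => F a x + G a x) := by
  obtain ⟨P, hP⟩ := hF
  obtain ⟨Q, hQ⟩ := hG
  exact ⟨P + Q, fun a x => by simp [hP, hQ]⟩

theorem IsPoly.sub {κ : A → τ → ℂ} {ι : X → σ → ℂ} {F G : A → X → ℂ}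
    (hF : IsPoly κ ι F) (hG : IsPoly κ ι G) : IsPoly κ ι (fun a x => F a x - G a x) := by
  obtain ⟨P, hP⟩ := hF
  obtain ⟨Q, hQ⟩ := hG
  exact ⟨P - Q, fun a x => by simp [hP, hQ]⟩

/-- Polynomial functions on a threefold product are regular. -/
theorem regular_of_isPoly {B ρ : Type} {κ : A → τ → ℂ} {ι : X → σ → ℂ} {μ : B → ρ → ℂ}
    {F : A → X → B → ℂ}
    (h : IsPoly (fun p : A × X => Sum.elim (κ p.1) (ι p.2)) μ (fun p b => F p.1 p.2 b)) :
    (((Space.ofCoords κ).prod (Space.ofCoords ι)).prod (Space.ofCoords μ)).Regular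
      (fun p => F p.1.1 p.1.2 p.2) := by
  obtain ⟨P, hP⟩ := h
  have h1 : ∀ P : MvPolynomial (τ ⊕ σ) ℂ,
      ((Space.ofCoords κ).prod (Space.ofCoords ι)).Regular
        (fun p => MvPolynomial.eval (Sum.elim (κ p.1) (ι p.2)) P) := fun P =>
    prod_regular (isTensorOn_poly κ ι P) (by simpa using isTensorOn_poly κ ι 1)
  have h2 : ∀ P : MvPolynomial ((τ ⊕ σ) ⊕ ρ) ℂ,
      IsTensorOn ((Space.ofCoords κ).prod (Space.ofCoords ι)) (Space.ofCoords μ)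
        Set.univ Set.univ (fun p => MvPolynomial.eval
          (Sum.elim (Sum.elim (κ p.1.1) (ι p.1.2)) (μ p.2)) P) := by
    intro P
    obtain ⟨k, p, q, h⟩ := poly_tensor P
    exact ⟨k, _, fun i x => MvPolynomial.eval (μ x) (q i),
      fun i a _ => h1 (p i) a, fun i x _ => ofCoords_regular (q i) x,
      fun a _ x _ => h _ _⟩
  have h3 := prod_regular (h2 P) (by simpa using h2 1)
  intro x
  convert h3 x using 2
  exact hP _ _

/-- A map which is polynomial in coordinates is a morphism. -/
theorem isMorphism_of_isPoly {κ : A → τ → ℂ} {ι : X → σ → ℂ} (φ : A × X → X)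
    (h : ∀ i, IsPoly κ ι (fun a x => ι (φ (a, x)) i)) :
    IsMorphism ((Space.ofCoords κ).prod (Space.ofCoords ι)) (Space.ofCoords ι) φ := by
  choose P hP using h
  have key : ∀ (r : MvPolynomial σ ℂ) (p : A × X), MvPolynomial.eval (ι (φ p)) r =
      MvPolynomial.eval (Sum.elim (κ p.1) (ι p.2)) (MvPolynomial.bind₁ P r) := by
    intro r p
    rw [← MvPolynomial.coe_aeval_eq_eval, ← MvPolynomial.coe_aeval_eq_eval]
    simp only [RingHom.coe_coe, MvPolynomial.aeval_bind₁]
    congr 2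
    funext i
    rw [MvPolynomial.aeval_eq_eval]
    exact hP i p.1 p.2
  have hcont : ∀ U : Set X, IsOpen[(Space.ofCoords ι).top] U →
      IsOpen[((Space.ofCoords κ).prod (Space.ofCoords ι)).top] (φ ⁻¹' U) := by
    have : @Continuous _ _ (prodTop (Space.ofCoords κ) (Space.ofCoords ι))
        ((zariski σ).induced ι) φ := by
      let := prodTop (Space.ofCoords κ) (Space.ofCoords ι)
      let := zariski σ
      refine continuous_induced_rng.2 (continuous_generateFrom_iff.2 ?_)
      rintro _ ⟨r, rfl⟩
      refine TopologicalSpace.isOpen_generateFrom_of_mem ⟨Set.univ, Set.univ, _,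
        isOpen_univ' _, isOpen_univ' _, isTensorOn_poly κ ι (MvPolynomial.bind₁ P r), ?_⟩
      ext p
      simp [key]
    exact (@continuous_def _ _ (prodTop (Space.ofCoords κ) (Space.ofCoords ι))
      ((zariski σ).induced ι) φ).1 this
  refine ⟨hcont, ?_⟩
  rintro f x ⟨U, hU, hx, p, q, h⟩
  refine ⟨Set.univ, Set.univ, φ ⁻¹' U, _, _, isOpen_univ' _, isOpen_univ' _, hcont U hU, hx,
    isTensorOn_poly κ ι (MvPolynomial.bind₁ P p), isTensorOn_poly κ ι (MvPolynomial.bind₁ P q),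
    fun y hy => ⟨Set.mem_univ _, Set.mem_univ _, ?_, ?_⟩⟩
  · have := (h _ hy).1
    rwa [key] at this
  · have := (h _ hy).2
    rwa [key, key] at this

end Coordinates

/-! ### The identity objects -/

section Identity

variable (n : ℕ)

/-- Coordinates on `T^*GL_n = GL_n × 𝔤𝔩_n`, with points `(g, φ)`. -/
def tstarCoords (z : GLn n × Mat n) :
    ((Fin n × Fin n) ⊕ (Fin n × Fin n)) ⊕ (Fin n × Fin n) → ℂ :=
  Sum.elim (glnCoords n z.1) (matCoords n z.2)

/-- Coordinates on `T^*GL_n × V_n^*`, with points `((g, φ), w)`; `w` is a row vector. -/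
def tstarFramedCoords (z : (GLn n × Mat n) × (Fin n → ℂ)) :
    (((Fin n × Fin n) ⊕ (Fin n × Fin n)) ⊕ (Fin n × Fin n)) ⊕ Fin n → ℂ :=
  Sum.elim (tstarCoords n z.1) z.2

/-- The action `(a, b) · (g, φ) = (a g b⁻¹, Ad_a φ)` on `T^*GL_n`. -/
abbrev tstarAction : MulAction (GLn n × GLn n) (GLn n × Mat n) where
  smul c z := (c.1 * z.1 * c.2⁻¹, c.1.1 * z.2 * (c.1⁻¹).1)
  one_smul z := by
    change ((1 : GLn n) * z.1 * 1⁻¹, (1 : GLn n).1 * z.2 * ((1 : GLn n)⁻¹).1) = z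
    simp
  mul_smul c d z := by
    change ((c.1 * d.1) * z.1 * (c.2 * d.2)⁻¹, (c.1 * d.1).1 * z.2 * ((c.1 * d.1)⁻¹).1) =
      (c.1 * (d.1 * z.1 * d.2⁻¹) * c.2⁻¹, c.1.1 * (d.1.1 * z.2 * (d.1⁻¹).1) * (c.1⁻¹).1)
    simp only [mul_inv_rev, Units.val_mul, mul_assoc]

/-- The action on `T^*GL_n × V_n^*`: the vector space `V_n^*` carries the representation of the
first factor dual to `V_n`. -/
abbrev tstarFramedAction : MulAction (GLn n × GLn n) ((GLn n × Mat n) × (Fin n → ℂ)) where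
  smul c z := ((c.1 * z.1.1 * c.2⁻¹, c.1.1 * z.1.2 * (c.1⁻¹).1), Matrix.vecMul z.2 (c.1⁻¹).1)
  one_smul z := by
    change (((1 : GLn n) * z.1.1 * 1⁻¹, (1 : GLn n).1 * z.1.2 * ((1 : GLn n)⁻¹).1),
      Matrix.vecMul z.2 ((1 : GLn n)⁻¹).1) = z
    simp
  mul_smul c d z := by
    change (((c.1 * d.1) * z.1.1 * (c.2 * d.2)⁻¹, (c.1 * d.1).1 * z.1.2 * ((c.1 * d.1)⁻¹).1),
        Matrix.vecMul z.2 ((c.1 * d.1)⁻¹).1) =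
      ((c.1 * (d.1 * z.1.1 * d.2⁻¹) * c.2⁻¹, c.1.1 * (d.1.1 * z.1.2 * (d.1⁻¹).1) * (c.1⁻¹).1),
        Matrix.vecMul (Matrix.vecMul z.2 (d.1⁻¹).1) (c.1⁻¹).1)
    simp only [mul_inv_rev, Units.val_mul, mul_assoc, Matrix.vecMul_vecMul]

/-- `Tr φ (X - Ad_g X')`. -/
def idPotential (X : Mat n) (z : GLn n × Mat n) (X' : Mat n) : ℂ :=
  Matrix.trace (z.2 * (X - z.1.1 * X' * (z.1⁻¹).1))

/-- `Tr φ (X - Ad_g X') + w · (v - g v')`. -/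
def idFramedPotential (x : Mat n × (Fin n → ℂ)) (z : (GLn n × Mat n) × (Fin n → ℂ))
    (x' : Mat n × (Fin n → ℂ)) : ℂ :=
  idPotential n x.1 z.1 x'.1 + dotProduct z.2 (x.2 - z.1.1.1.mulVec x'.2)

theorem isClosed_tstar {ρ : Type} :
    IsClosed[zariski (((Fin n × Fin n) ⊕ (Fin n × Fin n)) ⊕ ρ)]
      {x | ∀ i j, ∑ k, x (.inl (.inl (i, k))) * x (.inl (.inr (k, j))) =
        (1 : Mat n) i j} := by
  convert isClosed_zeros (fun e : Fin n × Fin n =>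
    (∑ k, MvPolynomial.X (.inl (.inl (e.1, k))) * MvPolynomial.X (.inl (.inr (k, e.2))) -
      MvPolynomial.C ((1 : Mat n) e.1 e.2) :
      MvPolynomial (((Fin n × Fin n) ⊕ (Fin n × Fin n)) ⊕ ρ) ℂ)) using 1
  ext x
  simp [sub_eq_zero]

theorem exists_gln (A B : Fin n × Fin n → ℂ)
    (h : ∀ i j, ∑ k, A (i, k) * B (k, j) = (1 : Mat n) i j) :
    ∃ g : GLn n, (∀ e, g.1 e.1 e.2 = A e) ∧ ∀ e, (g⁻¹).1 e.1 e.2 = B e := by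
  have h1 : (Matrix.of fun i j => A (i, j)) * (Matrix.of fun i j => B (i, j)) = (1 : Mat n) := by
    ext i j
    simpa [Matrix.mul_apply] using h i j
  exact ⟨⟨_, _, h1, mul_eq_one_comm.1 h1⟩, fun e => rfl, fun e => rfl⟩

theorem gln_mul_inv (g : GLn n) (i j : Fin n) :
    ∑ k, g.1 i k * (g⁻¹).1 k j = (1 : Mat n) i j := by
  have : g.1 * (g⁻¹).1 = 1 := g.mul_inv
  rw [← this, Matrix.mul_apply]

theorem glnCoords_injective : Function.Injective (glnCoords n) := by
  intro g h e
  ext i j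
  exact congrFun e (.inl (i, j))

theorem tstar_isVariety : (Space.ofCoords (tstarCoords n)).IsVariety := by
  refine ofCoords_isVariety ?_ ?_
  · rintro ⟨g, φ⟩ ⟨g', φ'⟩ h
    have h1 : g = g' := glnCoords_injective n (funext fun i => congrFun h (.inl i))
    have h2 : φ = φ' := by
      ext i j
      exact congrFun h (.inr (i, j))
    rw [h1, h2]
  · convert isClosed_tstar n (ρ := Fin n × Fin n) using 1
    ext x
    constructor
    · rintro ⟨z, rfl⟩ i j
      exact gln_mul_inv n z.1 i j
    · intro h
      obtain ⟨g, h1, h2⟩ := exists_gln n (fun e => x (.inl (.inl e))) (fun e => x (.inl (.inr e))) h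
      refine ⟨(g, Matrix.of fun i j => x (.inr (i, j))), ?_⟩
      ext ((e | e) | e)
      · exact h1 e
      · exact h2 e
      · rfl

theorem tstarFramed_isVariety : (Space.ofCoords (tstarFramedCoords n)).IsVariety := by
  refine ofCoords_isVariety ?_ ?_
  · rintro ⟨⟨g, φ⟩, w⟩ ⟨⟨g', φ'⟩, w'⟩ h
    have h1 : g = g' := glnCoords_injective n (funext fun i => congrFun h (.inl (.inl i)))
    have h2 : φ = φ' := by
      ext i j
      exact congrFun h (.inl (.inr (i, j)))
    have h3 : w = w' := funext fun i => congrFun h (.inr i)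
    rw [h1, h2, h3]
  · convert isClosed_zeros (fun e : Fin n × Fin n =>
      (∑ k, MvPolynomial.X (.inl (.inl (.inl (e.1, k)))) *
        MvPolynomial.X (.inl (.inl (.inr (k, e.2)))) - MvPolynomial.C ((1 : Mat n) e.1 e.2) :
        MvPolynomial ((((Fin n × Fin n) ⊕ (Fin n × Fin n)) ⊕ (Fin n × Fin n)) ⊕ Fin n) ℂ)) using 1
    ext x
    constructor
    · rintro ⟨z, rfl⟩ e
      have := gln_mul_inv n z.1.1 e.1 e.2
      simpa [sub_eq_zero, tstarFramedCoords, tstarCoords, glnCoords] using this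
    · intro h
      obtain ⟨g, h1, h2⟩ := exists_gln n (fun e => x (.inl (.inl (.inl e))))
        (fun e => x (.inl (.inl (.inr e)))) (fun i j => by simpa [sub_eq_zero] using h (i, j))
      refine ⟨((g, Matrix.of fun i j => x (.inl (.inr (i, j)))), fun i => x (.inr i)), ?_⟩
      ext (((e | e) | e) | e)
      · exact h1 e
      · exact h2 e
      · rfl
      · rfl

theorem isPoly_mul {A X τ σ : Type} {κ : A → τ → ℂ} {ι : X → σ → ℂ} {F G : A → X → Mat n}
    (hF : ∀ i j, IsPoly κ ι (fun a x => F a x i j)) (hG : ∀ i j, IsPoly κ ι (fun a x => G a x i j))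
    (i j : Fin n) : IsPoly κ ι (fun a x => (F a x * G a x) i j) := by
  simp only [Matrix.mul_apply]
  exact IsPoly.sum fun k => (hF i k).mul (hG k j)

theorem idPotential_invariant (a b g : GLn n) (X φ X' : Mat n) :
    idPotential n (a.1 * X * (a⁻¹).1) (a * g * b⁻¹, a.1 * φ * (a⁻¹).1) (b.1 * X' * (b⁻¹).1) =
      idPotential n X (g, φ) X' := by
  have ha : (a⁻¹).1 * a.1 = 1 := a.inv_mul
  have hb : (b⁻¹).1 * b.1 = 1 := b.inv_mul
  have e : a.1 * φ * (a⁻¹).1 * (a.1 * X * (a⁻¹).1 - (a.1 * g.1 * (b⁻¹).1) *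
      (b.1 * X' * (b⁻¹).1) * (b.1 * ((g⁻¹).1 * (a⁻¹).1))) =
      a.1 * (φ * (X - g.1 * X' * (g⁻¹).1)) * (a⁻¹).1 := by
    have h1 : ∀ M : Mat n, (a⁻¹).1 * (a.1 * M) = M := fun M => by rw [← mul_assoc, ha, one_mul]
    have h2 : ∀ M : Mat n, (b⁻¹).1 * (b.1 * M) = M := fun M => by rw [← mul_assoc, hb, one_mul]
    simp only [mul_sub, sub_mul, mul_assoc, h1, h2]
  unfold idPotential
  simp only [mul_inv_rev, inv_inv, Units.val_mul]
  rw [e, Matrix.trace_mul_comm, ← mul_assoc, ha, one_mul]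

theorem idPairing_invariant (a b g : GLn n) (v w v' : Fin n → ℂ) :
    dotProduct (Matrix.vecMul w (a⁻¹).1)
      (a.1.mulVec v - (a * g * b⁻¹).1.mulVec (b.1.mulVec v')) =
      dotProduct w (v - g.1.mulVec v') := by
  have ha : (a⁻¹).1 * a.1 = 1 := a.inv_mul
  have hb : (b⁻¹).1 * b.1 = 1 := b.inv_mul
  rw [← Matrix.dotProduct_mulVec, Matrix.mulVec_sub]
  simp only [Matrix.mulVec_mulVec, Units.val_mul]
  have h2 : (a⁻¹).1 * (a.1 * g.1 * (b⁻¹).1 * b.1) = g.1 := by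
    rw [mul_assoc (a.1 * g.1), hb, mul_one, ← mul_assoc, ha, one_mul]
  rw [h2, ha, Matrix.one_mulVec]

theorem idPotential_isPoly {A X τ σ : Type} {κ : A → τ → ℂ} {ι : X → σ → ℂ}
    {M φ g g' M' : A → X → Mat n}
    (hM : ∀ i j, IsPoly κ ι (fun a x => M a x i j)) (hφ : ∀ i j, IsPoly κ ι (fun a x => φ a x i j))
    (hg : ∀ i j, IsPoly κ ι (fun a x => g a x i j)) (hg' : ∀ i j, IsPoly κ ι (fun a x => g' a x i j))
    (hM' : ∀ i j, IsPoly κ ι (fun a x => M' a x i j)) :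
    IsPoly κ ι (fun a x => Matrix.trace (φ a x * (M a x - g a x * M' a x * g' a x))) :=
  IsPoly.sum fun i => isPoly_mul n hφ
    (fun i j => (hM i j).sub (isPoly_mul n (isPoly_mul n hg hM') hg' i j)) i i

/-- The unframed identity object `(T^*GL_n, Tr φ (X - Ad_g X'))`. -/
def idUnframed : HomObj .unframed n n where
  Z := Space.ofCoords (tstarCoords n)
  isVariety := tstar_isVariety n
  act := tstarAction n
  act_algebraic := by
    refine isMorphism_of_isPoly _ ?_
    let κ := fun g : GLn n × GLn n => Sum.elim (glnCoords n g.1) (glnCoords n g.2)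
    have A : ∀ i j, IsPoly κ (tstarCoords n) (fun a _ => a.1.1 i j) := fun i j =>
      IsPoly.left (Sum.inl (Sum.inl (i, j)))
    have A' : ∀ i j, IsPoly κ (tstarCoords n) (fun a _ => (a.1⁻¹).1 i j) := fun i j =>
      IsPoly.left (Sum.inl (Sum.inr (i, j)))
    have B : ∀ i j, IsPoly κ (tstarCoords n) (fun a _ => a.2.1 i j) := fun i j =>
      IsPoly.left (Sum.inr (Sum.inl (i, j)))
    have B' : ∀ i j, IsPoly κ (tstarCoords n) (fun a _ => (a.2⁻¹).1 i j) := fun i j =>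
      IsPoly.left (Sum.inr (Sum.inr (i, j)))
    have G : ∀ i j, IsPoly κ (tstarCoords n) (fun _ z => z.1.1 i j) := fun i j =>
      IsPoly.right (Sum.inl (Sum.inl (i, j)))
    have G' : ∀ i j, IsPoly κ (tstarCoords n) (fun _ z => (z.1⁻¹).1 i j) := fun i j =>
      IsPoly.right (Sum.inl (Sum.inr (i, j)))
    have P : ∀ i j, IsPoly κ (tstarCoords n) (fun _ z => z.2 i j) := fun i j =>
      IsPoly.right (Sum.inr (i, j))
    rintro ((⟨i, j⟩ | ⟨i, j⟩) | ⟨i, j⟩)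
    · exact isPoly_mul n (isPoly_mul n A G) B' i j
    · have := isPoly_mul n B (isPoly_mul n G' A') i j
      convert this using 4 with a z
      change (a.1 * z.1 * a.2⁻¹)⁻¹.1 _ _ = _
      simp only [mul_inv_rev, inv_inv, Units.val_mul]
    · exact isPoly_mul n (isPoly_mul n A P) A' i j
  w := idPotential n
  w_regular := by
    refine regular_of_isPoly (idPotential_isPoly n ?_ ?_ ?_ ?_ ?_)
    · exact fun i j => IsPoly.left (Sum.inl (i, j))
    · exact fun i j => IsPoly.left (Sum.inr (Sum.inr (i, j)))
    · exact fun i j => IsPoly.left (Sum.inr (Sum.inl (Sum.inl (i, j))))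
    · exact fun i j => IsPoly.left (Sum.inr (Sum.inl (Sum.inr (i, j))))
    · exact fun i j => IsPoly.right (i, j)
  w_invariant := by
    intro a b X z X'
    exact idPotential_invariant n a b z.1 X z.2 X'

/-- The framed identity object `(T^*GL_n × V_n^*, Tr φ (X - Ad_g X') + w · (v - g v'))`. -/
def idFramed : HomObj .framed n n where
  Z := Space.ofCoords (tstarFramedCoords n)
  isVariety := tstarFramed_isVariety n
  act := tstarFramedAction n
  act_algebraic := by
    refine isMorphism_of_isPoly _ ?_
    let κ := fun g : GLn n × GLn n => Sum.elim (glnCoords n g.1) (glnCoords n g.2)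
    have A : ∀ i j, IsPoly κ (tstarFramedCoords n) (fun a _ => a.1.1 i j) := fun i j =>
      IsPoly.left (Sum.inl (Sum.inl (i, j)))
    have A' : ∀ i j, IsPoly κ (tstarFramedCoords n) (fun a _ => (a.1⁻¹).1 i j) := fun i j =>
      IsPoly.left (Sum.inl (Sum.inr (i, j)))
    have B : ∀ i j, IsPoly κ (tstarFramedCoords n) (fun a _ => a.2.1 i j) := fun i j =>
      IsPoly.left (Sum.inr (Sum.inl (i, j)))
    have B' : ∀ i j, IsPoly κ (tstarFramedCoords n) (fun a _ => (a.2⁻¹).1 i j) := fun i j =>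
      IsPoly.left (Sum.inr (Sum.inr (i, j)))
    have G : ∀ i j, IsPoly κ (tstarFramedCoords n) (fun _ z => z.1.1.1 i j) := fun i j =>
      IsPoly.right (Sum.inl (Sum.inl (Sum.inl (i, j))))
    have G' : ∀ i j, IsPoly κ (tstarFramedCoords n) (fun _ z => (z.1.1⁻¹).1 i j) := fun i j =>
      IsPoly.right (Sum.inl (Sum.inl (Sum.inr (i, j))))
    have P : ∀ i j, IsPoly κ (tstarFramedCoords n) (fun _ z => z.1.2 i j) := fun i j =>
      IsPoly.right (Sum.inl (Sum.inr (i, j)))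
    rintro (((⟨i, j⟩ | ⟨i, j⟩) | ⟨i, j⟩) | i)
    · exact isPoly_mul n (isPoly_mul n A G) B' i j
    · have := isPoly_mul n B (isPoly_mul n G' A') i j
      convert this using 4 with a z
      change (a.1 * z.1.1 * a.2⁻¹)⁻¹.1 _ _ = _
      simp only [mul_inv_rev, inv_inv, Units.val_mul]
    · exact isPoly_mul n (isPoly_mul n A P) A' i j
    · exact IsPoly.sum fun j => (IsPoly.right (Sum.inr j)).mul (A' j i)
  w := idFramedPotential n
  w_regular := by
    refine regular_of_isPoly (IsPoly.add (idPotential_isPoly n ?_ ?_ ?_ ?_ ?_) ?_)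
    · exact fun i j => IsPoly.left (Sum.inl (Sum.inl (i, j)))
    · exact fun i j => IsPoly.left (Sum.inr (Sum.inl (Sum.inr (i, j))))
    · exact fun i j => IsPoly.left (Sum.inr (Sum.inl (Sum.inl (Sum.inl (i, j)))))
    · exact fun i j => IsPoly.left (Sum.inr (Sum.inl (Sum.inl (Sum.inr (i, j)))))
    · exact fun i j => IsPoly.right (Sum.inl (i, j))
    · have H : ∀ i, IsPoly (fun p : GlType .framed n × ((GLn n × Mat n) × (Fin n → ℂ)) =>
          Sum.elim (glCoords .framed n p.1) (tstarFramedCoords n p.2)) (glCoords .framed n)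
          (fun p b => ∑ j, p.2.1.1.1 i j * b.2 j) := fun i =>
        IsPoly.sum fun j => IsPoly.mul
          (IsPoly.left (Sum.inr (Sum.inl (Sum.inl (Sum.inl (i, j)))))) (IsPoly.right (Sum.inr j))
      exact IsPoly.sum fun i => IsPoly.mul (IsPoly.left (Sum.inr (Sum.inr i)))
        (IsPoly.sub (IsPoly.left (Sum.inl (Sum.inr i))) (H i))
  w_invariant := by
    intro a b x z x'
    exact congrArg₂ (· + ·) (idPotential_invariant n a b z.1.1 x.1 z.1.2 x'.1)
      (idPairing_invariant n a b z.1.1 x.2 z.2 x'.2)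

/-- The identity object `L_id^n` of `Hom(n^•, n^•)`. -/
def idObj : (fr : Framing) → (n : ℕ) → HomObj fr n n
  | .unframed, n => idUnframed n
  | .framed, n => idFramed n

end Identity

end

end KRS

/-!
The group component `g ∈ GL_n` of `T^*GL_n` makes the middle group act freely, and one can divide
by the action explicitly by normalizing `g = 1`.  The power `det g^{∓1}` is a nowhere vanishing
semi-invariant, so that all points are semistable, and the quotient of `T^*GL_n × 𝔤𝔩_n^• × Z` is
`(𝔤𝔩_n^•)^* × 𝔤𝔩_n^• × Z`, with quotient map `((g, φ), Y, z) ↦ (φ, Ad_g Y, (g, 1) · z)`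
(`left_isComposition`, and `right_isComposition` for the other side).  Since this morphism has
a section and its fibres are the orbits, it is a good quotient
(`isGoodQuotient_of_section`), and since points of a variety are closed, every good quotient of
the same action is isomorphic to it (`IsGoodQuotient.isIso_of_section`).

The potential on the quotient is `⟨φ, X - Y⟩ + w(Y, z, y)`.  In the coordinate `T = X - Y` it is
`⟨φ, T⟩ + W` with `W = w(X - T, z, y)`: the canonical pairing of the trivial bundle with fibre
`𝔤𝔩_n^•`, plus a function which restricts to `w` on the zero section `T = 0`.  This is an
elementary Knörrer equivalence with `(Z, w)`.  On the other side `T = Y - y`.  Both cases are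
instances of `DualPairData.knorrerStep`.

The framed and the unframed case are treated uniformly: `𝔤𝔩_n^•` is a representation of `GL_n`,
and its dual is identified with the same vector space by the trace form (`glPairing`), the action
becoming `glCoact`.  Morphisms are constructed from the universal property of the product
(`IsMorphism.pair`) and from the fact that a map to a space with coordinates is a morphism if its
coordinates are regular (`isMorphism_ofCoords`); both hold for sources whose stalks are local rings
(`Space.IsLocallyRinged`), in particular for all varieties.
-/

namespace KRS

open scoped Topology

noncomputable section

/-! ### Spaces whose stalks are local rings -/

/-- The stalks of `X` are local rings of germs of functions: regularity at a point is preserved by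
the ring operations and by inversion of non-vanishing functions, it is an open condition, and
a regular function which does not vanish at a point does not vanish nearby.  These are the only
properties of varieties used for the formal calculus of morphisms. -/
class Space.IsLocallyRinged (X : Space) : Prop where
  regAt_const : ∀ (c : ℂ) (x : X.carrier), X.RegAt (fun _ => c) x
  regAt_add : ∀ {f g : X.carrier → ℂ} {x : X.carrier}, X.RegAt f x → X.RegAt g x →
    X.RegAt (fun y => f y + g y) x
  regAt_mul : ∀ {f g : X.carrier → ℂ} {x : X.carrier}, X.RegAt f x → X.RegAt g x →
    X.RegAt (fun y => f y * g y) x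
  regAt_inv : ∀ {f : X.carrier → ℂ} {x : X.carrier}, X.RegAt f x → f x ≠ 0 →
    X.RegAt (fun y => (f y)⁻¹) x
  exists_regularOn : ∀ {f : X.carrier → ℂ} {x : X.carrier}, X.RegAt f x →
    ∃ U, IsOpen[X.top] U ∧ x ∈ U ∧ X.RegularOn U f
  exists_ne_zero : ∀ {f : X.carrier → ℂ} {x : X.carrier}, X.RegAt f x → f x ≠ 0 →
    ∃ U, IsOpen[X.top] U ∧ x ∈ U ∧ ∀ y ∈ U, f y ≠ 0

namespace Space.IsLocallyRinged

variable {X : Space} [X.IsLocallyRinged]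

theorem regAt_sum {J : Type} (s : Finset J) {f : J → X.carrier → ℂ} {x : X.carrier}
    (h : ∀ j, X.RegAt (f j) x) : X.RegAt (fun y => ∑ j ∈ s, f j y) x := by
  classical
  induction s using Finset.induction_on with
  | empty => simpa using regAt_const 0 x
  | insert j s hj ih =>
    simp only [Finset.sum_insert hj]
    exact regAt_add (h j) ih

theorem regAt_prod {J : Type} (s : Finset J) {f : J → X.carrier → ℂ} {x : X.carrier}
    (h : ∀ j, X.RegAt (f j) x) : X.RegAt (fun y => ∏ j ∈ s, f j y) x := by
  classical
  induction s using Finset.induction_on with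
  | empty => simpa using regAt_const 1 x
  | insert j s hj ih =>
    simp only [Finset.prod_insert hj]
    exact regAt_mul (h j) ih

theorem regAt_neg {f : X.carrier → ℂ} {x : X.carrier} (h : X.RegAt f x) :
    X.RegAt (fun y => -f y) x := by
  simpa using regAt_mul (regAt_const (-1) x) h

theorem regAt_sub {f g : X.carrier → ℂ} {x : X.carrier} (hf : X.RegAt f x) (hg : X.RegAt g x) :
    X.RegAt (fun y => f y - g y) x := by
  simpa [sub_eq_add_neg] using regAt_add hf (regAt_neg hg)

theorem regAt_eval {σ : Type} {f : X.carrier → σ → ℂ} {x : X.carrier}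
    (h : ∀ i, X.RegAt (fun y => f y i) x) (p : MvPolynomial σ ℂ) :
    X.RegAt (fun y => MvPolynomial.eval (f y) p) x := by
  induction p using MvPolynomial.induction_on with
  | C c => simpa using regAt_const c x
  | add p q hp hq => simpa using regAt_add hp hq
  | mul_X p i hp => simpa using regAt_mul hp (h i)

end Space.IsLocallyRinged

open Space.IsLocallyRinged

theorem Space.isOpen_of_forall_mem (X : Space) {S : Set X.carrier}
    (h : ∀ x ∈ S, ∃ U, IsOpen[X.top] U ∧ x ∈ U ∧ U ⊆ S) : IsOpen[X.top] S := by
  let := X.top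
  exact isOpen_iff_forall_mem_open.2 fun x hx =>
    let ⟨U, h1, h2, h3⟩ := h x hx
    ⟨U, h3, h1, h2⟩

/-- The locus where a function, regular on the open set `U`, does not vanish is open. -/
theorem Space.isOpen_ne_zero (X : Space) [X.IsLocallyRinged] {U : Set X.carrier}
    (hU : IsOpen[X.top] U) {f : X.carrier → ℂ} (hf : X.RegularOn U f) :
    IsOpen[X.top] {x | x ∈ U ∧ f x ≠ 0} := by
  refine X.isOpen_of_forall_mem fun x hx => ?_
  obtain ⟨V, hV, hxV, h⟩ := exists_ne_zero (hf x hx.1) hx.2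
  exact ⟨U ∩ V, @IsOpen.inter _ X.top _ _ hU hV, ⟨hx.1, hxV⟩, fun y hy => ⟨hy.1, h y hy.2⟩⟩

instance ofCoords_isLocallyRinged {X σ : Type} (ι : X → σ → ℂ) :
    (no_index (Space.ofCoords ι)).IsLocallyRinged where
  regAt_const c x := by simpa using ofCoords_regular (ι := ι) (MvPolynomial.C c) x
  regAt_add := by
    rintro f g x ⟨U, hU, hx, p, q, h⟩ ⟨U', hU', hx', p', q', h'⟩
    refine ⟨U ∩ U', @IsOpen.inter _ ((zariski σ).induced ι) _ _ hU hU', ⟨hx, hx'⟩,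
      p * q' + q * p', q * q', fun y hy => ?_⟩
    have h1 := h y hy.1
    have h2 := h' y hy.2
    simp only [map_mul, map_add]
    exact ⟨mul_ne_zero h1.1 h2.1, by rw [h1.2, h2.2, div_add_div _ _ h1.1 h2.1]⟩
  regAt_mul := by
    rintro f g x ⟨U, hU, hx, p, q, h⟩ ⟨U', hU', hx', p', q', h'⟩
    refine ⟨U ∩ U', @IsOpen.inter _ ((zariski σ).induced ι) _ _ hU hU', ⟨hx, hx'⟩,
      p * p', q * q', fun y hy => ?_⟩
    have h1 := h y hy.1
    have h2 := h' y hy.2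
    simp only [map_mul]
    exact ⟨mul_ne_zero h1.1 h2.1, by rw [h1.2, h2.2, div_mul_div_comm]⟩
  regAt_inv := by
    rintro f x ⟨U, hU, hx, p, q, h⟩ hfx
    refine ⟨U ∩ {x | MvPolynomial.eval (ι x) p ≠ 0}, @IsOpen.inter _ ((zariski σ).induced ι) _ _ hU
      (ofCoords_isOpen p), ⟨hx, fun h0 => hfx ?_⟩, q, p, fun y hy => ⟨hy.2, ?_⟩⟩
    · rw [(h x hx).2, h0, zero_div]
    · simp only [(h y hy.1).2, inv_div]
  exists_regularOn := by
    rintro f x ⟨U, hU, hx, p, q, h⟩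
    exact ⟨U, hU, hx, fun y hy => ⟨U, hU, hy, p, q, h⟩⟩
  exists_ne_zero := by
    rintro f x ⟨U, hU, hx, p, q, h⟩ hfx
    refine ⟨U ∩ {x | MvPolynomial.eval (ι x) p ≠ 0}, @IsOpen.inter _ ((zariski σ).induced ι) _ _ hU
      (ofCoords_isOpen p), ⟨hx, fun h0 => hfx ?_⟩, fun y hy => ?_⟩
    · rw [(h x hx).2, h0, zero_div]
    · rw [(h y hy.1).2]
      exact div_ne_zero hy.2 (h y hy.1).1

/-! ### Morphisms -/

theorem IsMorphism.id (X : Space) : IsMorphism X X (fun x => x) :=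
  ⟨fun _ h => h, fun _ _ h => h⟩

theorem IsMorphism.comp {X Y W : Space} {ψ : Y.carrier → W.carrier} {φ : X.carrier → Y.carrier}
    (hψ : IsMorphism Y W ψ) (hφ : IsMorphism X Y φ) : IsMorphism X W (fun x => ψ (φ x)) :=
  ⟨fun U hU => hφ.continuous _ (hψ.continuous U hU),
    fun f x hf => hφ.regular (fun y => f (ψ y)) x (hψ.regular f (φ x) hf)⟩

theorem IsMorphism.isClosed_preimage {X Y : Space} {φ : X.carrier → Y.carrier}
    (hφ : IsMorphism X Y φ) {A : Set Y.carrier} (hA : IsClosed[Y.top] A) :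
    IsClosed[X.top] (φ ⁻¹' A) := by
  let := X.top
  let := Y.top
  exact hA.preimage (continuous_def.2 hφ.continuous)

theorem IsMorphism.regular_comp {X Y : Space} {φ : X.carrier → Y.carrier} {f : Y.carrier → ℂ}
    (hφ : IsMorphism X Y φ) (hf : Y.Regular f) : X.Regular (fun x => f (φ x)) :=
  fun x => hφ.regular f x (hf _)

theorem IsMorphism.const (X Y : Space) [X.IsLocallyRinged] (y : Y.carrier) :
    IsMorphism X Y (fun _ => y) :=
  ⟨fun U _ => @isOpen_const _ X.top (y ∈ U), fun f x _ => regAt_const (f y) x⟩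

/-- A map into a space with coordinates is a morphism as soon as its coordinates are regular. -/
theorem isMorphism_ofCoords {P : Space} [P.IsLocallyRinged] {A σ : Type} {ι : A → σ → ℂ}
    {φ : P.carrier → A} (h : ∀ i, P.Regular (fun p => ι (φ p) i)) :
    IsMorphism P (Space.ofCoords ι) φ := by
  have key : ∀ r : MvPolynomial σ ℂ, P.Regular (fun p => MvPolynomial.eval (ι (φ p)) r) :=
    fun r x => regAt_eval (f := fun p => ι (φ p)) (fun i => h i x) r
  have hcont : ∀ U : Set A, IsOpen[(zariski σ).induced ι] U → IsOpen[P.top] (φ ⁻¹' U) := by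
    have : @Continuous _ _ P.top ((zariski σ).induced ι) φ := by
      let := P.top
      let := zariski σ
      refine continuous_induced_rng.2 (continuous_generateFrom_iff.2 ?_)
      rintro _ ⟨r, rfl⟩
      have := P.isOpen_ne_zero (isOpen_univ' P) (f := fun p => MvPolynomial.eval (ι (φ p)) r)
        (fun x _ => key r x)
      simpa using this
    exact (@continuous_def _ _ P.top ((zariski σ).induced ι) φ).1 this
  refine ⟨hcont, ?_⟩
  rintro f x ⟨U, hU, hx, p, q, hpq⟩
  refine P.congr' (fun y => MvPolynomial.eval (ι (φ y)) p * (MvPolynomial.eval (ι (φ y)) q)⁻¹) _ x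
    (φ ⁻¹' U) (hcont U hU) hx (fun y hy => ?_) (regAt_mul (key p x) (regAt_inv (key q x) (hpq _ hx).1))
  rw [(hpq _ hy).2, div_eq_mul_inv]

theorem IsMorphism.coord {P : Space} {A σ : Type} {ι : A → σ → ℂ}
    {φ : P.carrier → A} (h : IsMorphism P (Space.ofCoords ι) φ) (i : σ) :
    P.Regular (fun p => ι (φ p) i) := by
  simpa using h.regular_comp (ofCoords_regular (ι := ι) (MvPolynomial.X i))

/-! ### Products -/

section Products

variable {X Y : Space}

theorem IsTensorOn.mono {U U' : Set X.carrier} {V V' : Set Y.carrier}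
    {h : X.carrier × Y.carrier → ℂ} (hh : IsTensorOn X Y U V h) (hU : U' ⊆ U) (hV : V' ⊆ V) :
    IsTensorOn X Y U' V' h := by
  obtain ⟨k, f, g, hf, hg, e⟩ := hh
  exact ⟨k, f, g, fun i x hx => hf i x (hU hx), fun i y hy => hg i y (hV hy),
    fun x hx y hy => e x (hU hx) y (hV hy)⟩

theorem IsTensorOn.add {U : Set X.carrier} {V : Set Y.carrier}
    {h h' : X.carrier × Y.carrier → ℂ} (hh : IsTensorOn X Y U V h) (hh' : IsTensorOn X Y U V h') :
    IsTensorOn X Y U V (fun p => h p + h' p) := by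
  obtain ⟨k, f, g, hf, hg, e⟩ := hh
  obtain ⟨k', f', g', hf', hg', e'⟩ := hh'
  refine ⟨k + k', Fin.append f f', Fin.append g g', fun i => ?_, fun i => ?_, fun x hx y hy => ?_⟩
  · refine Fin.addCases (fun i => ?_) (fun i => ?_) i
    · simpa using hf i
    · simpa using hf' i
  · refine Fin.addCases (fun i => ?_) (fun i => ?_) i
    · simpa using hg i
    · simpa using hg' i
  · simp [Fin.sum_univ_add, e x hx y hy, e' x hx y hy]

theorem IsTensorOn.mul [X.IsLocallyRinged] [Y.IsLocallyRinged] {U : Set X.carrier}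
    {V : Set Y.carrier} {h h' : X.carrier × Y.carrier → ℂ}
    (hh : IsTensorOn X Y U V h) (hh' : IsTensorOn X Y U V h') :
    IsTensorOn X Y U V (fun p => h p * h' p) := by
  obtain ⟨k, f, g, hf, hg, e⟩ := hh
  obtain ⟨k', f', g', hf', hg', e'⟩ := hh'
  refine ⟨k * k', fun i x => f (finProdFinEquiv.symm i).1 x * f' (finProdFinEquiv.symm i).2 x,
    fun i y => g (finProdFinEquiv.symm i).1 y * g' (finProdFinEquiv.symm i).2 y,
    fun i x hx => regAt_mul (hf _ x hx) (hf' _ x hx), fun i y hy => regAt_mul (hg _ y hy) (hg' _ y hy),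
    fun x hx y hy => ?_⟩
  dsimp only
  rw [e x hx y hy, e' x hx y hy, Finset.sum_mul_sum, ← Finset.sum_product',
    Finset.univ_product_univ, ← Equiv.sum_comp finProdFinEquiv.symm]
  exact Finset.sum_congr rfl fun i _ => by ring

theorem IsTensorOn.left [Y.IsLocallyRinged] {U : Set X.carrier} {f : X.carrier → ℂ}
    (hf : X.RegularOn U f) (V : Set Y.carrier) : IsTensorOn X Y U V (fun p => f p.1) :=
  ⟨1, fun _ => f, fun _ _ => 1, fun _ => hf, fun _ y _ => regAt_const 1 y, fun x _ y _ => by simp⟩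

theorem IsTensorOn.right [X.IsLocallyRinged] {V : Set Y.carrier} {g : Y.carrier → ℂ}
    (hg : Y.RegularOn V g) (U : Set X.carrier) : IsTensorOn X Y U V (fun p => g p.2) :=
  ⟨1, fun _ _ => 1, fun _ => g, fun _ x _ => regAt_const 1 x, fun _ => hg, fun x _ y _ => by simp⟩

theorem isOpen_tensor_ne_zero {U : Set X.carrier} {V : Set Y.carrier}
    (hU : IsOpen[X.top] U) (hV : IsOpen[Y.top] V) {h : X.carrier × Y.carrier → ℂ}
    (hh : IsTensorOn X Y U V h) : IsOpen[prodTop X Y] {p | p.1 ∈ U ∧ p.2 ∈ V ∧ h p ≠ 0} :=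
  TopologicalSpace.isOpen_generateFrom_of_mem ⟨U, V, h, hU, hV, hh, rfl⟩

variable [X.IsLocallyRinged] [Y.IsLocallyRinged]

theorem isOpen_rect {U : Set X.carrier} {V : Set Y.carrier}
    (hU : IsOpen[X.top] U) (hV : IsOpen[Y.top] V) :
    IsOpen[prodTop X Y] {p | p.1 ∈ U ∧ p.2 ∈ V} := by
  simpa using isOpen_tensor_ne_zero hU hV (IsTensorOn.left (f := fun _ => 1)
    (fun x _ => regAt_const 1 x) V)

-- `no_index` because instance search would otherwise index the reducible unfolding of the product,
-- which does not match nested products.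
instance prod_isLocallyRinged : (no_index (X.prod Y)).IsLocallyRinged where
  regAt_const c x := ⟨Set.univ, Set.univ, Set.univ, fun _ => c, fun _ => 1, isOpen_univ' X,
    isOpen_univ' Y, isOpen_univ' (X.prod Y), Set.mem_univ x,
    IsTensorOn.left (f := fun _ => c) (fun x _ => regAt_const c x) _,
    IsTensorOn.left (f := fun _ => 1) (fun x _ => regAt_const 1 x) _, fun y _ => by simp⟩
  regAt_add := by
    rintro f g x ⟨U, V, W, p, q, hU, hV, hW, hx, hp, hq, h⟩
      ⟨U', V', W', p', q', hU', hV', hW', hx', hp', hq', h'⟩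
    have l {h} (hh : IsTensorOn X Y U V h) : IsTensorOn X Y (U ∩ U') (V ∩ V') h :=
      hh.mono Set.inter_subset_left Set.inter_subset_left
    have r {h} (hh : IsTensorOn X Y U' V' h) : IsTensorOn X Y (U ∩ U') (V ∩ V') h :=
      hh.mono Set.inter_subset_right Set.inter_subset_right
    refine ⟨U ∩ U', V ∩ V', W ∩ W', _, _, @IsOpen.inter _ X.top _ _ hU hU',
      @IsOpen.inter _ Y.top _ _ hV hV', @IsOpen.inter _ (prodTop X Y) _ _ hW hW', ⟨hx, hx'⟩,
      ((l hp).mul (r hq')).add ((l hq).mul (r hp')), (l hq).mul (r hq'), fun y hy => ?_⟩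
    obtain ⟨h1, h2, h3, h4⟩ := h y hy.1
    obtain ⟨h1', h2', h3', h4'⟩ := h' y hy.2
    exact ⟨⟨h1, h1'⟩, ⟨h2, h2'⟩, mul_ne_zero h3 h3', by simp only [h4, h4', div_add_div _ _ h3 h3']⟩
  regAt_mul := by
    rintro f g x ⟨U, V, W, p, q, hU, hV, hW, hx, hp, hq, h⟩
      ⟨U', V', W', p', q', hU', hV', hW', hx', hp', hq', h'⟩
    have l {h} (hh : IsTensorOn X Y U V h) : IsTensorOn X Y (U ∩ U') (V ∩ V') h :=
      hh.mono Set.inter_subset_left Set.inter_subset_left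
    have r {h} (hh : IsTensorOn X Y U' V' h) : IsTensorOn X Y (U ∩ U') (V ∩ V') h :=
      hh.mono Set.inter_subset_right Set.inter_subset_right
    refine ⟨U ∩ U', V ∩ V', W ∩ W', _, _, @IsOpen.inter _ X.top _ _ hU hU',
      @IsOpen.inter _ Y.top _ _ hV hV', @IsOpen.inter _ (prodTop X Y) _ _ hW hW', ⟨hx, hx'⟩,
      (l hp).mul (r hp'), (l hq).mul (r hq'), fun y hy => ?_⟩
    obtain ⟨h1, h2, h3, h4⟩ := h y hy.1
    obtain ⟨h1', h2', h3', h4'⟩ := h' y hy.2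
    exact ⟨⟨h1, h1'⟩, ⟨h2, h2'⟩, mul_ne_zero h3 h3', by simp only [h4, h4', div_mul_div_comm]⟩
  regAt_inv := by
    rintro f x ⟨U, V, W, p, q, hU, hV, hW, hx, hp, hq, h⟩ hfx
    refine ⟨U, V, W ∩ {y | y.1 ∈ U ∧ y.2 ∈ V ∧ p y ≠ 0}, q, p, hU, hV,
      @IsOpen.inter _ (prodTop X Y) _ _ hW (isOpen_tensor_ne_zero hU hV hp),
      ⟨hx, (h x hx).1, (h x hx).2.1, fun h0 => hfx ?_⟩, hq, hp, fun y hy =>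
      ⟨hy.2.1, hy.2.2.1, hy.2.2.2, ?_⟩⟩
    · rw [(h x hx).2.2.2, h0, zero_div]
    · simp only [(h y hy.1).2.2.2, inv_div]
  exists_regularOn := by
    rintro f x ⟨U, V, W, p, q, hU, hV, hW, hx, h⟩
    exact ⟨W, hW, hx, fun y hy => ⟨U, V, W, p, q, hU, hV, hW, hy, h⟩⟩
  exists_ne_zero := by
    rintro f x ⟨U, V, W, p, q, hU, hV, hW, hx, hp, hq, h⟩ hfx
    refine ⟨W ∩ {y | y.1 ∈ U ∧ y.2 ∈ V ∧ p y ≠ 0},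
      @IsOpen.inter _ (prodTop X Y) _ _ hW (isOpen_tensor_ne_zero hU hV hp),
      ⟨hx, (h x hx).1, (h x hx).2.1, fun h0 => hfx ?_⟩, fun y hy => ?_⟩
    · rw [(h x hx).2.2.2, h0, zero_div]
    · rw [(h y hy.1).2.2.2]
      exact div_ne_zero hy.2.2.2 (h y hy.1).2.2.1

variable (X Y) in
theorem isMorphism_fst : IsMorphism (X.prod Y) X (fun p => p.1) where
  continuous U hU := by
    have := isOpen_rect (Y := Y) hU (isOpen_univ' Y)
    simpa [Set.preimage] using this
  regular f x hf := by
    obtain ⟨U, hU, hx, h⟩ := exists_regularOn hf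
    exact ⟨U, Set.univ, {p | p.1 ∈ U ∧ p.2 ∈ Set.univ}, _, fun _ => 1, hU, isOpen_univ' Y,
      isOpen_rect hU (isOpen_univ' Y), ⟨hx, trivial⟩, IsTensorOn.left h _,
      IsTensorOn.left (f := fun _ => 1) (fun x _ => regAt_const 1 x) _, fun y hy =>
      ⟨hy.1, trivial, one_ne_zero, by simp⟩⟩

variable (X Y) in
theorem isMorphism_snd : IsMorphism (X.prod Y) Y (fun p => p.2) where
  continuous V hV := by
    have := isOpen_rect (X := X) (isOpen_univ' X) hV
    simpa [Set.preimage] using this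
  regular f x hf := by
    obtain ⟨V, hV, hx, h⟩ := exists_regularOn hf
    exact ⟨Set.univ, V, {p | p.1 ∈ Set.univ ∧ p.2 ∈ V}, _, fun _ => 1, isOpen_univ' X, hV,
      isOpen_rect (isOpen_univ' X) hV, ⟨trivial, hx⟩, IsTensorOn.right h _,
      IsTensorOn.left (f := fun _ => 1) (fun x _ => regAt_const 1 x) _, fun y hy =>
      ⟨trivial, hy.2, one_ne_zero, by simp⟩⟩

theorem IsMorphism.fst {P : Space} {φ : P.carrier → X.carrier × Y.carrier}
    (h : IsMorphism P (X.prod Y) φ) : IsMorphism P X (fun p => (φ p).1) :=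
  (isMorphism_fst X Y).comp h

theorem IsMorphism.snd {P : Space} {φ : P.carrier → X.carrier × Y.carrier}
    (h : IsMorphism P (X.prod Y) φ) : IsMorphism P Y (fun p => (φ p).2) :=
  (isMorphism_snd X Y).comp h

/-- The universal property of the product. -/
theorem IsMorphism.pair {P X Y : Space} [P.IsLocallyRinged] {φ : P.carrier → X.carrier}
    {ψ : P.carrier → Y.carrier} (hφ : IsMorphism P X φ) (hψ : IsMorphism P Y ψ) :
    IsMorphism P (X.prod Y) (fun p => (φ p, ψ p)) := by
  have key : ∀ U V h, IsTensorOn X Y U V h → IsOpen[X.top] U → IsOpen[Y.top] V →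
      P.RegularOn {p | φ p ∈ U ∧ ψ p ∈ V} (fun p => h (φ p, ψ p)) := by
    rintro U V h ⟨k, f, g, hf, hg, e⟩ hU hV x hx
    refine P.congr' (fun p => ∑ i, f i (φ p) * g i (ψ p)) _ x {p | φ p ∈ U ∧ ψ p ∈ V}
      (@IsOpen.inter _ P.top _ _ (hφ.continuous U hU) (hψ.continuous V hV)) hx
      (fun y hy => (e _ hy.1 _ hy.2).symm) ?_
    exact regAt_sum _ fun i =>
      regAt_mul (hφ.regular _ _ (hf i _ hx.1)) (hψ.regular _ _ (hg i _ hx.2))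
  have hcont : ∀ U : Set (X.carrier × Y.carrier), IsOpen[prodTop X Y] U →
      IsOpen[P.top] ((fun p => (φ p, ψ p)) ⁻¹' U) := by
    have : @Continuous _ _ P.top (prodTop X Y) (fun p => (φ p, ψ p)) := by
      let := P.top
      refine continuous_generateFrom_iff.2 ?_
      rintro _ ⟨U, V, h, hU, hV, hh, rfl⟩
      have := P.isOpen_ne_zero (@IsOpen.inter _ P.top _ _ (hφ.continuous U hU)
        (hψ.continuous V hV)) (key U V h hh hU hV)
      convert this using 1
      ext p
      simp [and_assoc]
    exact (@continuous_def _ _ P.top (prodTop X Y) _).1 this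
  refine ⟨hcont, ?_⟩
  rintro f x ⟨U, V, W, p, q, hU, hV, hW, hx, hp, hq, h⟩
  refine P.congr' (fun y => p (φ y, ψ y) * (q (φ y, ψ y))⁻¹) _ x _ (hcont W hW) hx
    (fun y hy => ?_) ?_
  · rw [(h _ hy).2.2.2, div_eq_mul_inv]
  · have hx' : φ x ∈ U ∧ ψ x ∈ V := ⟨(h _ hx).1, (h _ hx).2.1⟩
    exact regAt_mul (key U V p hp hU hV x hx')
      (regAt_inv (f := fun y => q (φ y, ψ y)) (key U V q hq hU hV x hx') (h _ hx).2.2.1)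

end Products

/-! ### Isomorphisms, open subspaces, gluing along a single chart -/

theorem IsIso.regAt_iff {X Y : Space} {e : X.carrier ≃ Y.carrier} (he : IsIso e)
    (f : Y.carrier → ℂ) (x : X.carrier) : Y.RegAt f (e x) ↔ X.RegAt (fun z => f (e z)) x := by
  refine ⟨he.1.regular f x, fun h => ?_⟩
  have := he.2.regular (fun z => f (e z)) (e x) (by simpa using h)
  simpa using this

theorem IsIso.isLocallyRinged {X Y : Space} [X.IsLocallyRinged] {e : X.carrier ≃ Y.carrier}
    (he : IsIso e) : Y.IsLocallyRinged where
  regAt_const c y := by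
    obtain ⟨x, rfl⟩ := e.surjective y
    exact (he.regAt_iff _ x).2 (regAt_const c x)
  regAt_add {f g y} hf hg := by
    obtain ⟨x, rfl⟩ := e.surjective y
    exact (he.regAt_iff _ x).2 (regAt_add ((he.regAt_iff _ x).1 hf) ((he.regAt_iff _ x).1 hg))
  regAt_mul {f g y} hf hg := by
    obtain ⟨x, rfl⟩ := e.surjective y
    exact (he.regAt_iff _ x).2 (regAt_mul ((he.regAt_iff _ x).1 hf) ((he.regAt_iff _ x).1 hg))
  regAt_inv {f y} hf h0 := by
    obtain ⟨x, rfl⟩ := e.surjective y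
    exact (he.regAt_iff _ x).2 (regAt_inv ((he.regAt_iff _ x).1 hf) h0)
  exists_regularOn {f y} hf := by
    obtain ⟨x, rfl⟩ := e.surjective y
    obtain ⟨U, hU, hx, h⟩ := exists_regularOn ((he.regAt_iff _ x).1 hf)
    refine ⟨e.symm ⁻¹' U, he.2.continuous U hU, by simpa using hx, fun z hz => ?_⟩
    obtain ⟨z, rfl⟩ := e.surjective z
    exact (he.regAt_iff _ z).2 (h z (by simpa using hz))
  exists_ne_zero {f y} hf h0 := by
    obtain ⟨x, rfl⟩ := e.surjective y
    obtain ⟨U, hU, hx, h⟩ := exists_ne_zero ((he.regAt_iff _ x).1 hf) h0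
    refine ⟨e.symm ⁻¹' U, he.2.continuous U hU, by simpa using hx, fun z hz => ?_⟩
    simpa using h _ hz

section Restrict

variable {X : Space} {U : Set X.carrier}

theorem restrict_regAt_iff (hU : IsOpen[X.top] U) (f : X.carrier → ℂ) (x : U) :
    (X.restrict U).RegAt (fun y => f y.1) x ↔ X.RegAt f x.1 := by
  constructor
  · exact X.congr' _ _ _ U hU x.2 fun y hy => by simp [hy]
  · exact X.congr' _ _ _ U hU x.2 fun y hy => by simp [hy]

/-- Regularity on an open subspace is defined by extending functions; any function on `U` is a
restriction, so that only restrictions need to be considered. -/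
theorem exists_extension (U : Set X.carrier) (f : U → ℂ) :
    ∃ g : X.carrier → ℂ, f = fun y => g y.1 :=
  ⟨Function.extend Subtype.val f 0, funext fun y => (Subtype.val_injective.extend_apply f 0 y).symm⟩

theorem restrict_isLocallyRinged [X.IsLocallyRinged] (hU : IsOpen[X.top] U) :
    (X.restrict U).IsLocallyRinged where
  regAt_const c x := (restrict_regAt_iff hU (fun _ => c) x).2 (regAt_const c x.1)
  regAt_add {f g x} hf hg := by
    obtain ⟨f, rfl⟩ := exists_extension U f
    obtain ⟨g, rfl⟩ := exists_extension U g
    exact (restrict_regAt_iff hU _ x).2 (regAt_add ((restrict_regAt_iff hU _ x).1 hf)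
      ((restrict_regAt_iff hU _ x).1 hg))
  regAt_mul {f g x} hf hg := by
    obtain ⟨f, rfl⟩ := exists_extension U f
    obtain ⟨g, rfl⟩ := exists_extension U g
    exact (restrict_regAt_iff hU _ x).2 (regAt_mul ((restrict_regAt_iff hU _ x).1 hf)
      ((restrict_regAt_iff hU _ x).1 hg))
  regAt_inv {f x} hf h0 := by
    obtain ⟨f, rfl⟩ := exists_extension U f
    exact (restrict_regAt_iff hU (fun y => (f y)⁻¹) x).2
      (regAt_inv ((restrict_regAt_iff hU _ x).1 hf) h0)
  exists_regularOn {f x} hf := by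
    obtain ⟨f, rfl⟩ := exists_extension U f
    obtain ⟨V, hV, hx, h⟩ := exists_regularOn ((restrict_regAt_iff hU _ x).1 hf)
    exact ⟨Subtype.val ⁻¹' V, ⟨V, hV, rfl⟩, hx, fun y hy => (restrict_regAt_iff hU _ y).2 (h _ hy)⟩
  exists_ne_zero {f x} hf h0 := by
    obtain ⟨f, rfl⟩ := exists_extension U f
    obtain ⟨V, hV, hx, h⟩ := exists_ne_zero ((restrict_regAt_iff hU _ x).1 hf) h0
    exact ⟨Subtype.val ⁻¹' V, ⟨V, hV, rfl⟩, hx, fun y hy => h _ hy⟩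

theorem isMorphism_val (hU : IsOpen[X.top] U) : IsMorphism (X.restrict U) X (fun x => x.1) :=
  ⟨fun V hV => ⟨V, hV, rfl⟩, fun f x hf => (restrict_regAt_iff hU f x).2 hf⟩

theorem IsMorphism.codRestrict {P : Space} {φ : P.carrier → X.carrier} (hφ : IsMorphism P X φ)
    (h : ∀ p, φ p ∈ U) : IsMorphism P (X.restrict U) (fun p => ⟨φ p, h p⟩) where
  continuous := by
    rintro _ ⟨V, hV, rfl⟩
    exact hφ.continuous V hV
  regular f x hf := by
    have := hφ.regular _ _ hf
    simpa [h] using this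

theorem isOpen_image_val (hU : IsOpen[X.top] U) {V : Set U}
    (hV : IsOpen[(X.restrict U).top] V) : IsOpen[X.top] (Subtype.val '' V) := by
  obtain ⟨W, hW, rfl⟩ := hV
  rw [Subtype.image_preimage_val]
  exact @IsOpen.inter _ X.top _ _ hU hW

theorem isLocallyRinged_of_cover
    (h : ∀ x, ∃ U, IsOpen[X.top] U ∧ x ∈ U ∧ (X.restrict U).IsLocallyRinged) :
    X.IsLocallyRinged where
  regAt_const c x := by
    obtain ⟨U, hU, hx, _⟩ := h x
    exact (restrict_regAt_iff hU (fun _ => c) ⟨x, hx⟩).1 (regAt_const c _)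
  regAt_add {f g x} hf hg := by
    obtain ⟨U, hU, hx, _⟩ := h x
    exact (restrict_regAt_iff hU _ ⟨x, hx⟩).1 (regAt_add
      ((restrict_regAt_iff hU _ ⟨x, hx⟩).2 hf) ((restrict_regAt_iff hU _ ⟨x, hx⟩).2 hg))
  regAt_mul {f g x} hf hg := by
    obtain ⟨U, hU, hx, _⟩ := h x
    exact (restrict_regAt_iff hU _ ⟨x, hx⟩).1 (regAt_mul
      ((restrict_regAt_iff hU _ ⟨x, hx⟩).2 hf) ((restrict_regAt_iff hU _ ⟨x, hx⟩).2 hg))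
  regAt_inv {f x} hf h0 := by
    obtain ⟨U, hU, hx, _⟩ := h x
    exact (restrict_regAt_iff hU (fun y => (f y)⁻¹) ⟨x, hx⟩).1
      (regAt_inv ((restrict_regAt_iff hU f ⟨x, hx⟩).2 hf) h0)
  exists_regularOn {f x} hf := by
    obtain ⟨U, hU, hx, _⟩ := h x
    obtain ⟨V, hV, hxV, h⟩ := exists_regularOn ((restrict_regAt_iff hU f ⟨x, hx⟩).2 hf)
    refine ⟨_, isOpen_image_val hU hV, ⟨_, hxV, rfl⟩, ?_⟩
    rintro _ ⟨y, hy, rfl⟩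
    exact (restrict_regAt_iff hU f y).1 (h y hy)
  exists_ne_zero {f x} hf h0 := by
    obtain ⟨U, hU, hx, _⟩ := h x
    obtain ⟨V, hV, hxV, h⟩ := exists_ne_zero ((restrict_regAt_iff hU f ⟨x, hx⟩).2 hf) h0
    refine ⟨_, isOpen_image_val hU hV, ⟨_, hxV, rfl⟩, ?_⟩
    rintro _ ⟨y, hy, rfl⟩
    exact h y hy

end Restrict

/-- Gluing a single space along a bijection does not change it. -/
theorem isIso_glue {E I : Type} [Unique I] {M : I → Space} {d : ∀ i, (M i).carrier → E}
    (e : (M default).carrier ≃ E) (hd : ∀ x, d default x = e x) :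
    IsIso (X := M default) (Y := Space.glue M d) e := by
  have hd' : d default = e := funext hd
  constructor
  · refine ⟨fun U hU => ?_, ?_⟩
    · have := isOpen_coinduced.1 ((isOpen_iSup_iff.1 hU) default)
      rwa [hd'] at this
    · rintro f x ⟨i, y, hy, h⟩
      obtain rfl := Subsingleton.elim i default
      rw [hd'] at hy h
      rwa [← e.injective hy]
  · refine ⟨fun U hU => ?_, fun f x h => ?_⟩
    · refine isOpen_iSup_iff.2 fun i => isOpen_coinduced.2 ?_
      obtain rfl := Subsingleton.elim i default
      rw [hd', ← Set.preimage_comp]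
      simpa using hU
    · exact ⟨default, e.symm x, by simp [hd'], by simpa [hd'] using h⟩

/-! ### Varieties -/

theorem isAffine_iff {X : Space} : X.IsAffine ↔ ∃ (σ : Type) (_ : Finite σ)
    (ι : X.carrier → σ → ℂ), Function.Injective ι ∧ IsClosed[zariski σ] (Set.range ι) ∧
      IsMorphism X (Space.ofCoords ι) (fun x => x) ∧
      IsMorphism (Space.ofCoords ι) X (fun x => x) := by
  constructor
  · rintro ⟨σ, hσ, ι, h1, h2, h3, h4⟩
    exact ⟨σ, hσ, ι, h1, h2, ⟨fun U hU => by rw [h3]; exact hU, fun f x hf => (h4 f x).2 hf⟩,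
      ⟨fun U hU => by rw [h3] at hU; exact hU, fun f x hf => (h4 f x).1 hf⟩⟩
  · rintro ⟨σ, hσ, ι, h1, h2, h3, h4⟩
    refine ⟨σ, hσ, ι, h1, h2, ?_, fun f x => ⟨h4.regular f x, h3.regular f x⟩⟩
    exact TopologicalSpace.ext_iff.2 fun U => ⟨h4.continuous U, h3.continuous U⟩

theorem Space.IsAffine.isLocallyRinged {X : Space} (h : X.IsAffine) : X.IsLocallyRinged := by
  obtain ⟨σ, _, ι, -, -, h3, h4⟩ := isAffine_iff.1 h
  exact IsIso.isLocallyRinged (X := Space.ofCoords ι) (Y := X) (e := Equiv.refl _) ⟨h4, h3⟩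

theorem Space.IsVariety.isLocallyRinged {X : Space} (h : X.IsVariety) : X.IsLocallyRinged := by
  obtain ⟨k, U, hU, hc, ha⟩ := h.charts
  refine isLocallyRinged_of_cover fun x => ?_
  obtain ⟨i, hi⟩ := Set.mem_iUnion.1 (hc ▸ Set.mem_univ x)
  exact ⟨U i, hU i, hi, (ha i).isLocallyRinged⟩

instance {fr : Framing} {n m : ℕ} (L : HomObj fr n m) : L.Z.IsLocallyRinged :=
  L.isVariety.isLocallyRinged

theorem Space.IsVariety.isClosed_singleton {X : Space} (h : X.IsVariety) (x : X.carrier) :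
    IsClosed[X.top] {x} := by
  have := h.isLocallyRinged
  have := ((IsMorphism.id X).pair (IsMorphism.const X X x)).isClosed_preimage h.separated
  convert this using 1
  ext y
  simp

/-- A product of Zariski closed subsets of affine spaces is Zariski closed. -/
theorem isClosed_range_sumElim {A B σ τ : Type} {ι : A → σ → ℂ} {κ : B → τ → ℂ}
    (hι : IsClosed[zariski σ] (Set.range ι)) (hκ : IsClosed[zariski τ] (Set.range κ)) :
    IsClosed[zariski (σ ⊕ τ)] (Set.range fun p : A × B => Sum.elim (ι p.1) (κ p.2)) := by
  have h {ρ : Type} (j : ρ → σ ⊕ τ) : @Continuous _ _ (zariski (σ ⊕ τ)) (zariski ρ)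
      (fun x i => x (j i)) := by
    let := zariski (σ ⊕ τ)
    refine continuous_generateFrom_iff.2 ?_
    rintro _ ⟨p, rfl⟩
    refine TopologicalSpace.isOpen_generateFrom_of_mem ⟨MvPolynomial.rename j p, ?_⟩
    ext x
    simp [MvPolynomial.eval_rename, Function.comp_def]
  let := zariski (σ ⊕ τ)
  let := zariski σ
  let := zariski τ
  convert (hι.preimage (h Sum.inl)).inter (hκ.preimage (h Sum.inr)) using 1
  ext x
  constructor
  · rintro ⟨p, rfl⟩
    exact ⟨⟨p.1, rfl⟩, ⟨p.2, rfl⟩⟩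
  · rintro ⟨⟨a, ha⟩, ⟨b, hb⟩⟩
    refine ⟨(a, b), ?_⟩
    ext (i | i)
    · exact congrFun ha i
    · exact congrFun hb i

theorem restrict_rect_isAffine {X Y : Space} [X.IsLocallyRinged] [Y.IsLocallyRinged]
    {U : Set X.carrier} {V : Set Y.carrier} (hU : IsOpen[X.top] U) (hV : IsOpen[Y.top] V)
    (aU : (X.restrict U).IsAffine) (aV : (Y.restrict V).IsAffine) :
    ((X.prod Y).restrict {p | p.1 ∈ U ∧ p.2 ∈ V}).IsAffine := by
  obtain ⟨σ, _, ι, h1, h2, h3, h4⟩ := isAffine_iff.1 aU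
  obtain ⟨τ, _, κ, k1, k2, k3, k4⟩ := isAffine_iff.1 aV
  have hW := isOpen_rect hU hV
  have := restrict_isLocallyRinged (X := X.prod Y) hW
  let F : {p : X.carrier × Y.carrier | p.1 ∈ U ∧ p.2 ∈ V} → U × V :=
    fun p => (⟨p.1.1, p.2.1⟩, ⟨p.1.2, p.2.2⟩)
  have hF : Function.Surjective F := fun p => ⟨⟨(p.1.1, p.2.1), p.1.2, p.2.2⟩, rfl⟩
  let ν : {p : X.carrier × Y.carrier | p.1 ∈ U ∧ p.2 ∈ V} → σ ⊕ τ → ℂ :=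
    fun p => Sum.elim (ι (F p).1) (κ (F p).2)
  have v := isMorphism_val (X := X.prod Y) hW
  refine isAffine_iff.2 ⟨σ ⊕ τ, inferInstance, ν, fun p q h => ?_, ?_, ?_, ?_⟩
  · have e1 : (F p).1 = (F q).1 := h1 (funext fun i => congrFun h (.inl i))
    have e2 : (F p).2 = (F q).2 := k1 (funext fun i => congrFun h (.inr i))
    exact Subtype.ext (Prod.ext (congrArg Subtype.val e1) (congrArg Subtype.val e2))
  · convert isClosed_range_sumElim h2 k2 using 1
    exact hF.range_comp (fun p : U × V => Sum.elim (ι p.1) (κ p.2))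
  · refine isMorphism_ofCoords ?_
    rintro (i | i)
    · exact (h3.comp (v.fst.codRestrict fun p => p.2.1)).coord i
    · exact (k3.comp (v.snd.codRestrict fun p => p.2.2)).coord i
  · have c := IsMorphism.id (Space.ofCoords ν)
    have m1 : IsMorphism (Space.ofCoords ν) (Space.ofCoords ι) (fun p => (F p).1) :=
      isMorphism_ofCoords fun i => c.coord (.inl i)
    have m2 : IsMorphism (Space.ofCoords ν) (Space.ofCoords κ) (fun p => (F p).2) :=
      isMorphism_ofCoords fun i => c.coord (.inr i)
    exact (((isMorphism_val hU).comp (h4.comp m1)).pair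
      ((isMorphism_val hV).comp (k4.comp m2))).codRestrict (X := X.prod Y) (fun p => p.2)

theorem Space.IsVariety.prod {X Y : Space} (hX : X.IsVariety) (hY : Y.IsVariety) :
    (X.prod Y).IsVariety := by
  have := hX.isLocallyRinged
  have := hY.isLocallyRinged
  constructor
  · obtain ⟨k, U, hU, hc, ha⟩ := hX.charts
    obtain ⟨l, V, hV, hd, hb⟩ := hY.charts
    refine ⟨k * l, fun i => {p | p.1 ∈ U (finProdFinEquiv.symm i).1 ∧
      p.2 ∈ V (finProdFinEquiv.symm i).2}, fun i => isOpen_rect (hU _) (hV _), ?_,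
      fun i => restrict_rect_isAffine (hU _) (hV _) (ha _) (hb _)⟩
    refine Set.eq_univ_of_forall fun p => Set.mem_iUnion.2 ?_
    obtain ⟨i, hi⟩ := Set.mem_iUnion.1 (hc ▸ Set.mem_univ p.1)
    obtain ⟨j, hj⟩ := Set.mem_iUnion.1 (hd ▸ Set.mem_univ p.2)
    exact ⟨finProdFinEquiv (i, j), by simpa using ⟨hi, hj⟩⟩
  · have f := isMorphism_fst (X.prod Y) (X.prod Y)
    have s := isMorphism_snd (X.prod Y) (X.prod Y)
    have h1 := (f.fst.pair s.fst).isClosed_preimage hX.separated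
    have h2 := (f.snd.pair s.snd).isClosed_preimage hY.separated
    let := ((X.prod Y).prod (X.prod Y)).top
    convert IsClosed.inter h1 h2 using 1
    ext p
    exact Prod.ext_iff

/-! ### Good quotients -/

/-- An invariant morphism with a section, whose fibres are the equivalence classes, is a good
quotient. -/
theorem isGoodQuotient_of_section {X Q : Space} {r : X.carrier → X.carrier → Prop}
    {π : X.carrier → Q.carrier} {s : Q.carrier → X.carrier} (hπ : IsMorphism X Q π)
    (hs : IsMorphism Q X s) (hπs : ∀ q, π (s q) = q) (hr : ∀ x y, r x y ↔ π x = π y) :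
    IsGoodQuotient X Q r π := by
  -- The image of an invariant set is its preimage under the section.
  have key : ∀ A : Set X.carrier, (∀ x ∈ A, ∀ y, r x y → y ∈ A) → π '' A = s ⁻¹' A := by
    intro A hA
    ext q
    constructor
    · rintro ⟨x, hx, rfl⟩
      exact hA x hx _ ((hr _ _).2 (hπs _).symm)
    · exact fun h => ⟨s q, h, hπs q⟩
  refine ⟨hπ, fun q => ⟨s q, hπs q⟩, fun x y h => (hr x y).1 h, fun U f hU hf hi => ?_,
    fun A hA hi => ?_, fun A B _ _ hiA hiB h => ?_⟩
  · refine ⟨fun q => f (s q), fun q hq => hs.regular f q (hf _ ?_), fun x hx => ?_⟩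
    · simpa [hπs] using hq
    · exact hi x hx _ ((hr _ _).2 (hπs _).symm)
  · rw [key A hi]
    exact hs.isClosed_preimage hA
  · rw [key A hiA, key B hiB]
    exact h.preimage s

/-- Good quotients by the same relation are isomorphic, if one of them separates the classes and
has a section. -/
theorem IsGoodQuotient.isIso_of_section {X Q Q' : Space} [Q.IsLocallyRinged]
    {r : X.carrier → X.carrier → Prop} {π : X.carrier → Q.carrier} {π' : X.carrier → Q'.carrier}
    (h' : IsGoodQuotient X Q' r π') {s : Q.carrier → X.carrier} (hπ : IsMorphism X Q π)
    (hs : IsMorphism Q X s) (hπs : ∀ q, π (s q) = q) (hr : ∀ x y, r x y ↔ π x = π y)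
    (hQ : ∀ q : Q.carrier, IsClosed[Q.top] {q}) :
    ∃ e : Q.carrier ≃ Q'.carrier, IsIso e ∧ ∀ x, e (π x) = π' x := by
  have hsπ : ∀ x, π' (s (π x)) = π' x := fun x => h'.invariant _ _ ((hr _ _).2 (hπs _))
  have inv : ∀ A : Set Q.carrier, ∀ x ∈ π ⁻¹' A, ∀ y, r x y → y ∈ π ⁻¹' A := by
    intro A x hx y hxy
    rwa [Set.mem_preimage, ← (hr x y).1 hxy]
  -- Distinct classes are disjoint closed invariant sets, hence have disjoint images in `Q'`.
  have inj : Function.Injective fun q => π' (s q) := by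
    intro p q hpq
    by_contra hne
    have hd := h'.disjoint _ _ (hπ.isClosed_preimage (hQ p)) (hπ.isClosed_preimage (hQ q))
      (inv {p}) (inv {q}) ((Set.disjoint_singleton.2 hne).preimage π)
    exact Set.disjoint_left.1 hd ⟨s p, hπs p, rfl⟩ ⟨s q, hπs q, hpq.symm⟩
  have surj : Function.Surjective fun q => π' (s q) := fun y => by
    obtain ⟨x, rfl⟩ := h'.surjective y
    exact ⟨π x, hsπ x⟩
  let e : Q.carrier ≃ Q'.carrier := Equiv.ofBijective _ ⟨inj, surj⟩
  have heπ : ∀ x, e (π x) = π' x := hsπ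
  have himage : ∀ A : Set Q.carrier, π' '' (π ⁻¹' A) = e.symm ⁻¹' A := by
    intro A
    ext y
    constructor
    · rintro ⟨x, hx, rfl⟩
      rw [← heπ]
      simpa using hx
    · intro hy
      obtain ⟨x, rfl⟩ := h'.surjective y
      refine ⟨x, ?_, rfl⟩
      rw [← heπ] at hy
      simpa using hy
  have hopen : ∀ U : Set Q.carrier, IsOpen[Q.top] U → IsOpen[Q'.top] (e.symm ⁻¹' U) := by
    intro U hU
    let := Q.top
    let := Q'.top
    have h1 : IsClosed (π' '' (π ⁻¹' Uᶜ)) :=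
      h'.closed _ (hπ.isClosed_preimage hU.isClosed_compl) (inv Uᶜ)
    rw [himage] at h1
    simpa using h1.isOpen_compl
  refine ⟨e, ⟨h'.morphism.comp hs, hopen, fun f q hf => ?_⟩, heπ⟩
  obtain ⟨U, hU, hq, hfU⟩ := exists_regularOn hf
  have hpre : ∀ x, x ∈ π' ⁻¹' (e.symm ⁻¹' U) ↔ π x ∈ U := fun x => by simp [← heπ]
  obtain ⟨f', hf', hff'⟩ := h'.functions (e.symm ⁻¹' U) (fun x => f (π x)) (hopen U hU)
    (fun x hx => hπ.regular f x (hfU _ ((hpre x).1 hx)))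
    (fun x _ y hxy => by rw [(hr x y).1 hxy])
  refine Q'.congr' f' _ q _ (hopen U hU) hq (fun y hy => ?_) (hf' q hq)
  obtain ⟨x, rfl⟩ := h'.surjective y
  rw [← hff' x hy, ← heπ, e.symm_apply_apply]

/-! ### The linear representations `𝔤𝔩_n^•` and their duals -/

instance : (fr : Framing) → (n : ℕ) → AddCommGroup (GlType fr n)
  | .unframed, n => inferInstanceAs (AddCommGroup (Mat n))
  | .framed, n => inferInstanceAs (AddCommGroup (Mat n × (Fin n → ℂ)))

instance : (fr : Framing) → (n : ℕ) → Module ℂ (GlType fr n)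
  | .unframed, n => inferInstanceAs (Module ℂ (Mat n))
  | .framed, n => inferInstanceAs (Module ℂ (Mat n × (Fin n → ℂ)))

instance : (fr : Framing) → (n : ℕ) → Fintype (GlIndex fr n)
  | .unframed, n => inferInstanceAs (Fintype (Fin n × Fin n))
  | .framed, n => inferInstanceAs (Fintype ((Fin n × Fin n) ⊕ Fin n))

/-- The standard coordinates as a linear isomorphism. -/
def glCoordsEquiv : (fr : Framing) → (n : ℕ) → GlType fr n ≃ₗ[ℂ] (GlIndex fr n → ℂ)
  | .unframed, n =>
    { toFun := glCoords .unframed n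
      invFun := fun c => Matrix.of fun i j => c (i, j)
      map_add' := fun _ _ => rfl
      map_smul' := fun _ _ => rfl
      left_inv := fun _ => rfl
      right_inv := fun _ => rfl }
  | .framed, n =>
    { toFun := glCoords .framed n
      invFun := fun c => (Matrix.of fun i j => c (.inl (i, j)), fun i => c (.inr i))
      map_add' := fun _ _ => by ext (_ | _) <;> rfl
      map_smul' := fun _ _ => by ext (_ | _) <;> rfl
      left_inv := fun _ => rfl
      right_inv := fun _ => by ext (_ | _) <;> rfl }

theorem glCoordsEquiv_apply (fr : Framing) (n : ℕ) (x : GlType fr n) :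
    glCoordsEquiv fr n x = glCoords fr n x := by
  cases fr <;> rfl

/-- The permutation of the coordinates which exchanges a basis with its dual basis for the
trace form: transposition on matrices, the identity on vectors. -/
def dualIndex : (fr : Framing) → (n : ℕ) → GlIndex fr n ≃ GlIndex fr n
  | .unframed, n => Equiv.prodComm (Fin n) (Fin n)
  | .framed, n => Equiv.sumCongr (Equiv.prodComm (Fin n) (Fin n)) (Equiv.refl (Fin n))

/-- The pairing `Tr(φ T)`, respectively `Tr(φ T) + w · t`, in coordinates. -/
def glPairing (fr : Framing) (n : ℕ) (φ T : GlType fr n) : ℂ :=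
  ∑ e, glCoords fr n φ (dualIndex fr n e) * glCoords fr n T e

/-- The action of `GL_n` on the dual of `𝔤𝔩_n^•`, whose elements are written as pairs of a
matrix and a row vector. -/
def glCoact : (fr : Framing) → (n : ℕ) → GLn n → GlType fr n → GlType fr n
  | .unframed, _, a => fun φ => a.1 * φ * (a⁻¹).1
  | .framed, _, a => fun φ => (a.1 * φ.1 * (a⁻¹).1, Matrix.vecMul φ.2 (a⁻¹).1)

theorem glPairing_unframed (n : ℕ) (φ T : Mat n) :
    glPairing .unframed n φ T = Matrix.trace (φ * T) := by
  change ∑ e : Fin n × Fin n, φ e.2 e.1 * T e.1 e.2 = _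
  simp only [Matrix.trace, Matrix.diag, Matrix.mul_apply]
  rw [Fintype.sum_prod_type, Finset.sum_comm]

theorem glPairing_framed (n : ℕ) (φ T : Mat n × (Fin n → ℂ)) :
    glPairing .framed n φ T = Matrix.trace (φ.1 * T.1) + dotProduct φ.2 T.2 := by
  rw [← glPairing_unframed]
  exact Fintype.sum_sum_type _

theorem trace_conj (n : ℕ) (a : GLn n) (φ T : Mat n) :
    Matrix.trace (a.1 * φ * (a⁻¹).1 * (a.1 * T * (a⁻¹).1)) = Matrix.trace (φ * T) := by
  have h : (a⁻¹).1 * a.1 = 1 := a.inv_mul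
  have e : a.1 * φ * (a⁻¹).1 * (a.1 * T * (a⁻¹).1) = a.1 * (φ * ((a⁻¹).1 * a.1) * T) * (a⁻¹).1 := by
    noncomm_ring
  rw [e, Matrix.trace_mul_comm, ← mul_assoc, h, one_mul, mul_one]

theorem glPairing_glCoact (fr : Framing) (n : ℕ) (a : GLn n) (φ T : GlType fr n) :
    glPairing fr n (glCoact fr n a φ) (glAct fr n a T) = glPairing fr n φ T := by
  cases fr
  · rw [glPairing_unframed, glPairing_unframed]
    exact trace_conj n a φ T
  · rw [glPairing_framed, glPairing_framed]
    have h : (a⁻¹).1 * a.1 = 1 := a.inv_mul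
    refine congrArg₂ (· + ·) (trace_conj n a φ.1 T.1) ?_
    change dotProduct (Matrix.vecMul φ.2 (a⁻¹).1) (a.1.mulVec T.2) = _
    rw [Matrix.dotProduct_mulVec, Matrix.vecMul_vecMul, h, Matrix.vecMul_one]

theorem glAct_one (fr : Framing) (n : ℕ) (x : GlType fr n) : glAct fr n 1 x = x := by
  cases fr <;> simp [glAct]

theorem glAct_mul (fr : Framing) (n : ℕ) (a b : GLn n) (x : GlType fr n) :
    glAct fr n (a * b) x = glAct fr n a (glAct fr n b x) := by
  cases fr <;> simp [glAct, mul_assoc]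

theorem glCoact_one (fr : Framing) (n : ℕ) (x : GlType fr n) : glCoact fr n 1 x = x := by
  cases fr <;> simp [glCoact]

theorem glCoact_mul (fr : Framing) (n : ℕ) (a b : GLn n) (x : GlType fr n) :
    glCoact fr n (a * b) x = glCoact fr n a (glCoact fr n b x) := by
  cases fr <;> simp [glCoact, mul_assoc]

theorem glAct_inv_glAct (fr : Framing) (n : ℕ) (a : GLn n) (x : GlType fr n) :
    glAct fr n a⁻¹ (glAct fr n a x) = x := by
  rw [← glAct_mul, inv_mul_cancel, glAct_one]

theorem glAct_glAct_inv (fr : Framing) (n : ℕ) (a : GLn n) (x : GlType fr n) :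
    glAct fr n a (glAct fr n a⁻¹ x) = x := by
  rw [← glAct_mul, mul_inv_cancel, glAct_one]

theorem glAct_add (fr : Framing) (n : ℕ) (a : GLn n) (x y : GlType fr n) :
    glAct fr n a (x + y) = glAct fr n a x + glAct fr n a y := by
  cases fr
  · change a.1 * (x + y) * (a⁻¹).1 = a.1 * x * (a⁻¹).1 + a.1 * y * (a⁻¹).1
    rw [mul_add, add_mul]
  · change (a.1 * (x.1 + y.1) * (a⁻¹).1, a.1.mulVec (x.2 + y.2)) =
      (a.1 * x.1 * (a⁻¹).1 + a.1 * y.1 * (a⁻¹).1, a.1.mulVec x.2 + a.1.mulVec y.2)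
    rw [mul_add, add_mul, Matrix.mulVec_add]

theorem glAct_smul (fr : Framing) (n : ℕ) (a : GLn n) (c : ℂ) (x : GlType fr n) :
    glAct fr n a (c • x) = c • glAct fr n a x := by
  cases fr
  · change a.1 * (c • x : Mat n) * (a⁻¹).1 = c • (a.1 * x * (a⁻¹).1 : Mat n)
    rw [mul_smul_comm, smul_mul_assoc]
  · change (a.1 * (c • x.1 : Mat n) * (a⁻¹).1, a.1.mulVec (c • x.2)) =
      (c • (a.1 * x.1 * (a⁻¹).1 : Mat n), c • a.1.mulVec x.2)
    rw [mul_smul_comm, smul_mul_assoc, Matrix.mulVec_smul]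

/-- The action of an element of `GL_n` on `𝔤𝔩_n^•` as a linear automorphism. -/
def glActEquiv (fr : Framing) (n : ℕ) (a : GLn n) : GlType fr n ≃ₗ[ℂ] GlType fr n where
  toFun := glAct fr n a
  invFun := glAct fr n a⁻¹
  map_add' := glAct_add fr n a
  map_smul' := glAct_smul fr n a
  left_inv := glAct_inv_glAct fr n a
  right_inv := glAct_glAct_inv fr n a

theorem glAct_sub (fr : Framing) (n : ℕ) (a : GLn n) (x y : GlType fr n) :
    glAct fr n a (x - y) = glAct fr n a x - glAct fr n a y :=
  map_sub (glActEquiv fr n a) x y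

theorem glCoords_add (fr : Framing) (n : ℕ) (x y : GlType fr n) (i : GlIndex fr n) :
    glCoords fr n (x + y) i = glCoords fr n x i + glCoords fr n y i := by
  simp only [← glCoordsEquiv_apply, map_add, Pi.add_apply]

theorem glCoords_sub (fr : Framing) (n : ℕ) (x y : GlType fr n) (i : GlIndex fr n) :
    glCoords fr n (x - y) i = glCoords fr n x i - glCoords fr n y i := by
  simp only [← glCoordsEquiv_apply, map_sub, Pi.sub_apply]

theorem glCoords_injective (fr : Framing) (n : ℕ) : Function.Injective (glCoords fr n) := by
  intro x y h
  simpa [← glCoordsEquiv_apply] using h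

theorem glSpace_isVariety (fr : Framing) (n : ℕ) : (glSpace fr n).IsVariety := by
  refine ofCoords_isVariety (glCoords_injective fr n) ?_
  have : Set.range (glCoords fr n) = Set.univ := by
    refine Set.range_eq_univ.2 fun c => ⟨(glCoordsEquiv fr n).symm c, ?_⟩
    rw [← glCoordsEquiv_apply, LinearEquiv.apply_symm_apply]
  rw [this]
  exact @isClosed_univ _ (zariski _)

/-! ### Morphisms between the groups and representations -/

/-- The algebraic group `GL_n`. -/
abbrev glnSpace (n : ℕ) : Space := Space.ofCoords (glnCoords n)

section Morphisms

variable {P : Space} [P.IsLocallyRinged] {fr : Framing} {n m : ℕ}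

theorem isMorphism_glnSpace_iff {g : P.carrier → GLn n} : IsMorphism P (glnSpace n) g ↔
    (∀ i j, P.Regular fun p => (g p).1 i j) ∧ ∀ i j, P.Regular fun p => ((g p)⁻¹).1 i j := by
  constructor
  · exact fun h => ⟨fun i j => h.coord (.inl (i, j)), fun i j => h.coord (.inr (i, j))⟩
  · rintro ⟨h1, h2⟩
    refine isMorphism_ofCoords ?_
    rintro (e | e)
    · exact h1 e.1 e.2
    · exact h2 e.1 e.2

theorem IsMorphism.inv_gln {g : P.carrier → GLn n} (h : IsMorphism P (glnSpace n) g) :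
    IsMorphism P (glnSpace n) (fun p => (g p)⁻¹) := by
  rw [isMorphism_glnSpace_iff] at h ⊢
  simpa only [inv_inv] using h.symm

theorem regular_matrix_mul {A B : P.carrier → Mat n} (hA : ∀ i j, P.Regular fun p => A p i j)
    (hB : ∀ i j, P.Regular fun p => B p i j) (i j : Fin n) :
    P.Regular fun p => (A p * B p) i j := by
  intro x
  simp only [Matrix.mul_apply]
  exact regAt_sum _ fun k => regAt_mul (hA i k x) (hB k j x)

theorem regular_det {A : P.carrier → Mat n} (hA : ∀ i j, P.Regular fun p => A p i j) :
    P.Regular fun p => (A p).det := by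
  intro x
  simp only [Matrix.det_apply']
  exact regAt_sum _ fun s => regAt_mul (regAt_const _ x) (regAt_prod _ fun i => hA _ _ x)

theorem IsMorphism.groupSpace {a : P.carrier → GLn n} {b : P.carrier → GLn m}
    (ha : IsMorphism P (glnSpace n) a) (hb : IsMorphism P (glnSpace m) b) :
    IsMorphism P (groupSpace n m) (fun p => (a p, b p)) := by
  refine isMorphism_ofCoords ?_
  rintro (e | e)
  · exact ha.coord e
  · exact hb.coord e

theorem isMorphism_groupSpace_fst : IsMorphism (groupSpace n m) (glnSpace n) (fun a => a.1) :=
  isMorphism_ofCoords fun i => (IsMorphism.id (groupSpace n m)).coord (.inl i)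

theorem isMorphism_groupSpace_snd : IsMorphism (groupSpace n m) (glnSpace m) (fun a => a.2) :=
  isMorphism_ofCoords fun i => (IsMorphism.id (groupSpace n m)).coord (.inr i)

theorem IsMorphism.glAct {g : P.carrier → GLn n} {Y : P.carrier → GlType fr n}
    (hg : IsMorphism P (glnSpace n) g) (hY : IsMorphism P (glSpace fr n) Y) :
    IsMorphism P (glSpace fr n) (fun p => glAct fr n (g p) (Y p)) := by
  obtain ⟨h1, h2⟩ := isMorphism_glnSpace_iff.1 hg
  refine isMorphism_ofCoords ?_
  cases fr
  · exact fun e => regular_matrix_mul (regular_matrix_mul h1 fun i j => hY.coord (i, j)) h2 e.1 e.2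
  · rintro (e | i)
    · exact regular_matrix_mul (regular_matrix_mul h1 fun i j => hY.coord (.inl (i, j))) h2 e.1 e.2
    · intro x
      have : P.RegAt (fun p => ∑ j, (g p).1 i j * (Y p).2 j) x :=
        regAt_sum _ fun j => regAt_mul (h1 i j x) (hY.coord (.inr j) x)
      exact this

theorem IsMorphism.glCoact {g : P.carrier → GLn n} {Y : P.carrier → GlType fr n}
    (hg : IsMorphism P (glnSpace n) g) (hY : IsMorphism P (glSpace fr n) Y) :
    IsMorphism P (glSpace fr n) (fun p => glCoact fr n (g p) (Y p)) := by
  obtain ⟨h1, h2⟩ := isMorphism_glnSpace_iff.1 hg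
  refine isMorphism_ofCoords ?_
  cases fr
  · exact fun e => regular_matrix_mul (regular_matrix_mul h1 fun i j => hY.coord (i, j)) h2 e.1 e.2
  · rintro (e | i)
    · exact regular_matrix_mul (regular_matrix_mul h1 fun i j => hY.coord (.inl (i, j))) h2 e.1 e.2
    · intro x
      have : P.RegAt (fun p => ∑ j, (Y p).2 j * ((g p)⁻¹).1 j i) x :=
        regAt_sum _ fun j => regAt_mul (hY.coord (.inr j) x) (h2 j i x)
      exact this

theorem IsMorphism.add {Y T : P.carrier → GlType fr n} (hY : IsMorphism P (glSpace fr n) Y)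
    (hT : IsMorphism P (glSpace fr n) T) : IsMorphism P (glSpace fr n) (fun p => Y p + T p) :=
  isMorphism_ofCoords fun i x => by
    simp only [glCoords_add]
    exact regAt_add (hY.coord i x) (hT.coord i x)

theorem IsMorphism.sub {Y T : P.carrier → GlType fr n} (hY : IsMorphism P (glSpace fr n) Y)
    (hT : IsMorphism P (glSpace fr n) T) : IsMorphism P (glSpace fr n) (fun p => Y p - T p) :=
  isMorphism_ofCoords fun i x => by
    simp only [glCoords_sub]
    exact regAt_sub (hY.coord i x) (hT.coord i x)

theorem IsMorphism.glPairing {φ T : P.carrier → GlType fr n} (hφ : IsMorphism P (glSpace fr n) φ)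
    (hT : IsMorphism P (glSpace fr n) T) : P.Regular (fun p => glPairing fr n (φ p) (T p)) :=
  fun x => regAt_sum _ fun _ => regAt_mul (hφ.coord _ x) (hT.coord _ x)

theorem HomObj.isMorphism_smul (L : HomObj fr n m) {a : P.carrier → GLn n} {b : P.carrier → GLn m}
    {z : P.carrier → L.Z.carrier} (ha : IsMorphism P (glnSpace n) a)
    (hb : IsMorphism P (glnSpace m) b) (hz : IsMorphism P L.Z z) :
    IsMorphism P L.Z (fun p => (a p, b p) • z p) :=
  L.act_algebraic.comp ((ha.groupSpace hb).pair hz)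

theorem HomObj.regular_w (L : HomObj fr n m) {X : P.carrier → GlType fr n}
    {z : P.carrier → L.Z.carrier} {y : P.carrier → GlType fr m}
    (hX : IsMorphism P (glSpace fr n) X) (hz : IsMorphism P L.Z z)
    (hy : IsMorphism P (glSpace fr m) y) : P.Regular (fun p => L.w (X p) (z p) (y p)) :=
  ((hX.pair hz).pair hy).regular_comp L.w_regular

end Morphisms

/-! ### The coordinates of the identity objects -/

section IdentityCoordinates

/-- The component `g` of a point of `L_id^n`. -/
def idGroup : (fr : Framing) → (n : ℕ) → (idObj fr n).Z.carrier → GLn n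
  | .unframed, n => fun z : GLn n × Mat n => z.1
  | .framed, n => fun z : (GLn n × Mat n) × (Fin n → ℂ) => z.1.1

/-- The component `φ`, respectively `(φ, w)`, of a point of `L_id^n`. -/
def idFibre : (fr : Framing) → (n : ℕ) → (idObj fr n).Z.carrier → GlType fr n
  | .unframed, n => fun z : GLn n × Mat n => z.2
  | .framed, n => fun z : (GLn n × Mat n) × (Fin n → ℂ) => (z.1.2, z.2)

/-- The point of `L_id^n` with given components. -/
def idMk : (fr : Framing) → (n : ℕ) → GLn n → GlType fr n → (idObj fr n).Z.carrier
  | .unframed, n => fun g φ => show GLn n × Mat n from (g, φ)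
  | .framed, n => fun g φ => show (GLn n × Mat n) × (Fin n → ℂ) from ((g, φ.1), φ.2)

variable {fr : Framing} {n : ℕ}

theorem idGroup_idMk (g : GLn n) (φ : GlType fr n) : idGroup fr n (idMk fr n g φ) = g := by
  cases fr <;> rfl

theorem idFibre_idMk (g : GLn n) (φ : GlType fr n) : idFibre fr n (idMk fr n g φ) = φ := by
  cases fr <;> rfl

theorem idMk_eta (z : (idObj fr n).Z.carrier) :
    idMk fr n (idGroup fr n z) (idFibre fr n z) = z := by
  cases fr <;> rfl

theorem idObj_smul (a b g : GLn n) (φ : GlType fr n) :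
    (a, b) • idMk fr n g φ = idMk fr n (a * g * b⁻¹) (glCoact fr n a φ) := by
  cases fr <;> rfl

theorem idObj_w (X : GlType fr n) (z : (idObj fr n).Z.carrier) (X' : GlType fr n) :
    (idObj fr n).w X z X' =
      glPairing fr n (idFibre fr n z) (X - glAct fr n (idGroup fr n z) X') := by
  cases fr
  · exact (glPairing_unframed n _ _).symm
  · obtain ⟨⟨g, φ⟩, w⟩ := z
    obtain ⟨X, v⟩ := X
    obtain ⟨X', v'⟩ := X'
    change idPotential n X (g, φ) X' + dotProduct w (v - g.1.mulVec v') =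
      glPairing .framed n (φ, w) (X - g.1 * X' * (g⁻¹).1, v - g.1.mulVec v')
    rw [glPairing_framed]
    rfl

variable {P : Space} [P.IsLocallyRinged]

theorem IsMorphism.idGroup {z : P.carrier → (idObj fr n).Z.carrier}
    (hz : IsMorphism P (idObj fr n).Z z) : IsMorphism P (glnSpace n) (fun p => idGroup fr n (z p)) := by
  cases fr
  · exact isMorphism_ofCoords fun i =>
      IsMorphism.coord (ι := tstarCoords n) hz (.inl i)
  · exact isMorphism_ofCoords fun i =>
      IsMorphism.coord (ι := tstarFramedCoords n) hz (.inl (.inl i))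

theorem IsMorphism.idFibre {z : P.carrier → (idObj fr n).Z.carrier}
    (hz : IsMorphism P (idObj fr n).Z z) :
    IsMorphism P (glSpace fr n) (fun p => idFibre fr n (z p)) := by
  cases fr
  · exact isMorphism_ofCoords fun i =>
      IsMorphism.coord (ι := tstarCoords n) hz (.inr i)
  · refine isMorphism_ofCoords ?_
    rintro (i | i)
    · exact IsMorphism.coord (ι := tstarFramedCoords n) hz (.inl (.inr i))
    · exact IsMorphism.coord (ι := tstarFramedCoords n) hz (.inr i)

theorem IsMorphism.idMk {g : P.carrier → GLn n} {φ : P.carrier → GlType fr n}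
    (hg : IsMorphism P (glnSpace n) g) (hφ : IsMorphism P (glSpace fr n) φ) :
    IsMorphism P (idObj fr n).Z (fun p => idMk fr n (g p) (φ p)) := by
  cases fr
  · refine isMorphism_ofCoords (ι := tstarCoords n) ?_
    rintro (i | i)
    · exact show P.Regular fun p => glnCoords n (g p) i from hg.coord i
    · exact hφ.coord i
  · refine isMorphism_ofCoords (ι := tstarFramedCoords n) ?_
    rintro ((i | i) | i)
    · exact show P.Regular fun p => glnCoords n (g p) i from hg.coord i
    · exact hφ.coord (.inl i)
    · exact hφ.coord (.inr i)

end IdentityCoordinates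

/-! ### Isomorphisms of objects and uniqueness of compositions -/

theorem IsIso.trans {X Y W : Space} {e : X.carrier ≃ Y.carrier} {f : Y.carrier ≃ W.carrier}
    (he : IsIso e) (hf : IsIso f) : IsIso (X := X) (Y := W) (e.trans f) :=
  ⟨hf.1.comp he.1, he.2.comp hf.2⟩

variable {fr : Framing} {n m k : ℕ}

/-- `e` is an equivariant isomorphism of varieties which identifies the potentials. -/
structure HomObj.IsIsoTo (K K' : HomObj fr n m) (e : K.Z.carrier ≃ K'.Z.carrier) : Prop where
  isIso : IsIso e
  map_smul : ∀ (g : GLn n × GLn m) z, e (g • z) = g • e z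
  map_w : ∀ X z y, K'.w X (e z) y = K.w X z y

theorem KnorrerStep.trans_iso {L K K' : HomObj fr n m} (h : KnorrerStep L K)
    {e : K.Z.carrier ≃ K'.Z.carrier} (he : K.IsIsoTo K' e) : KnorrerStep L K' := by
  obtain ⟨V, W, Φ, h1, h2, h3, h4, h5, h6, h7⟩ := h
  let Ψ : (((glSpace fr n).prod K'.Z).prod (glSpace fr m)).carrier ≃
      (((glSpace fr n).prod K.Z).prod (glSpace fr m)).carrier :=
    Equiv.prodCongr (Equiv.prodCongr (Equiv.refl _) e.symm) (Equiv.refl _)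
  have hΨ : IsIso (X := ((glSpace fr n).prod K'.Z).prod (glSpace fr m))
      (Y := ((glSpace fr n).prod K.Z).prod (glSpace fr m)) Ψ := by
    have f := isMorphism_fst ((glSpace fr n).prod K'.Z) (glSpace fr m)
    have s := isMorphism_snd ((glSpace fr n).prod K'.Z) (glSpace fr m)
    have f' := isMorphism_fst ((glSpace fr n).prod K.Z) (glSpace fr m)
    have s' := isMorphism_snd ((glSpace fr n).prod K.Z) (glSpace fr m)
    exact ⟨(f.fst.pair (he.isIso.2.comp f.snd)).pair s,
      (f'.fst.pair (he.isIso.1.comp f'.snd)).pair s'⟩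
  have hsmul : ∀ (g : GLn n × GLn m) z, e.symm (g • z) = g • e.symm z := fun g z => by
    rw [Equiv.symm_apply_eq, he.map_smul, Equiv.apply_symm_apply]
  refine ⟨V, W, Ψ.trans Φ, h1, h2, h3, hΨ.trans h4, fun x z y => h5 x (e.symm z) y,
    fun a b x z y => ?_, fun x z y => ?_⟩
  · have := h6 a b x (e.symm z) y
    rw [← hsmul] at this
    exact this
  · have := h7 x (e.symm z) y
    rw [← he.map_w, Equiv.apply_symm_apply] at this
    exact this

/-- If all points are semistable and the orbits of the middle group are the fibres of a morphism
with a section onto an object `K₀`, compatible with the remaining action and the potentials,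
then `K₀` is the composition, uniquely up to isomorphism. -/
theorem isComposition_of_section {L : HomObj fr n k} {L' : HomObj fr k m} {K₀ : HomObj fr n m}
    {π : (compSpace L L').carrier → K₀.Z.carrier} {s : K₀.Z.carrier → (compSpace L L').carrier}
    (hss : ∀ x, x ∈ semistable (compSpace L L') (midAct L L'))
    (hπ : IsMorphism (compSpace L L') K₀.Z π) (hs : IsMorphism K₀.Z (compSpace L L') s)
    (hπs : ∀ q, π (s q) = q) (hr : ∀ x y, (∃ b : GLn k, y = midAct L L' b x) ↔ π x = π y)
    (hout : ∀ a c x, π (outAct L L' a c x) = (a, c) • π x)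
    (hw : ∀ X x Y, K₀.w X (π x) Y = L.w X x.1.1 x.1.2 + L'.w x.1.2 x.2 Y) :
    IsComposition L L' K₀ ∧ ∀ K, IsComposition L L' K → ∃ e, K₀.IsIsoTo K e := by
  have hopen : IsOpen[(compSpace L L').top] (semistable (compSpace L L') (midAct L L')) := by
    rw [Set.eq_univ_of_forall hss]
    exact isOpen_univ' _
  have hπ' := hπ.comp (isMorphism_val hopen)
  have hs' := hs.codRestrict (fun q => hss (s q))
  have hr' : ∀ x y : semistable (compSpace L L') (midAct L L'),
      (∃ b : GLn k, y.1 = midAct L L' b x.1) ↔ π x.1 = π y.1 := fun x y => hr x.1 y.1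
  refine ⟨⟨fun x => π x.1, isGoodQuotient_of_section hπ' hs' hπs hr',
    fun a c x y h => (congrArg π h).trans (hout a c x.1), fun X x Y => hw X x.1 Y⟩, ?_⟩
  rintro K ⟨π', hq, hout', hw'⟩
  obtain ⟨e, he, heπ⟩ := hq.isIso_of_section hπ' hs' hπs hr' K₀.isVariety.isClosed_singleton
  have hsurj : ∀ z, ∃ x : semistable (compSpace L L') (midAct L L'), π x.1 = z :=
    fun z => ⟨⟨s z, hss _⟩, hπs z⟩
  refine ⟨e, he, ?_, ?_⟩
  · rintro ⟨a, c⟩ z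
    obtain ⟨x, rfl⟩ := hsurj z
    rw [heπ, ← hout' a c x ⟨outAct L L' a c x.1, hss _⟩ rfl, ← heπ]
    exact congrArg e (hout a c x.1).symm
  · intro X z y
    obtain ⟨x, rfl⟩ := hsurj z
    rw [heπ, hw', hw]

/-! ### Trivial equivariant bundles -/

section TrivialBundle

/-- The linear isomorphism of `𝔤𝔩_s^•` with a standard vector space. -/
def glTriv (fr : Framing) (s : ℕ) :
    GlType fr s ≃ₗ[ℂ] (Fin (Fintype.card (GlIndex fr s)) → ℂ) :=
  (glCoordsEquiv fr s).trans
    (LinearEquiv.funCongrLeft ℂ ℂ (Fintype.equivFin (GlIndex fr s)).symm)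

theorem glTriv_apply (s : ℕ) (T : GlType fr s) (e : Fin (Fintype.card (GlIndex fr s))) :
    glTriv fr s T e = glCoords fr s T ((Fintype.equivFin (GlIndex fr s)).symm e) := by
  rw [← glCoordsEquiv_apply]
  rfl

theorem glCoords_glTriv_symm (s : ℕ) (c : Fin (Fintype.card (GlIndex fr s)) → ℂ)
    (i : GlIndex fr s) :
    glCoords fr s ((glTriv fr s).symm c) i = c (Fintype.equivFin (GlIndex fr s) i) := by
  have := glTriv_apply s ((glTriv fr s).symm c) (Fintype.equivFin (GlIndex fr s) i)
  rw [LinearEquiv.apply_symm_apply, Equiv.symm_apply_apply] at this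
  exact this.symm

/-- The trivial bundle with fibre `𝔤𝔩_s^•`. -/
def trivialBundle (Z : Space) [Z.IsLocallyRinged] (fr : Framing) (s : ℕ) : VectorBundle Z where
  fib _ := GlType fr s
  I := Unit
  U _ := Set.univ
  isOpen_U _ := isOpen_univ' Z
  cover _ := ⟨(), trivial⟩
  rank _ := Fintype.card (GlIndex fr s)
  triv _ _ := glTriv fr s
  transition i j v e := by
    have := restrict_isLocallyRinged (X := Z) (U := Set.univ ∩ Set.univ)
      (by simp)
    intro x
    simpa using regAt_const (v e) x

variable (Z : Space) [Z.IsLocallyRinged] (s : ℕ)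

/-- The bijection along which the total space of the trivial bundle is glued. -/
def totalChart (Z : Space) [Z.IsLocallyRinged] (fr : Framing) (s : ℕ) :
    ((Z.restrict Set.univ).prod (affineSpace (Fintype.card (GlIndex fr s)))).carrier ≃
      (trivialBundle Z fr s).total.carrier where
  toFun p := ⟨p.1.1, (glTriv fr s).symm p.2⟩
  invFun t := (⟨t.1, trivial⟩, glTriv fr s t.2)
  left_inv p := by simp
  right_inv t := by
    refine Sigma.ext rfl (heq_of_eq ?_)
    exact (glTriv fr s).symm_apply_apply t.2

theorem isIso_totalChart :
    IsIso (X := (Z.restrict Set.univ).prod (affineSpace (Fintype.card (GlIndex fr s))))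
      (Y := (trivialBundle Z fr s).total) (totalChart Z fr s) :=
  isIso_glue (I := Unit) (M := fun _ : Unit =>
    (Z.restrict Set.univ).prod (affineSpace (Fintype.card (GlIndex fr s)))) _ fun _ => rfl

instance total_isLocallyRinged : (trivialBundle Z fr s).total.IsLocallyRinged := by
  have := restrict_isLocallyRinged (isOpen_univ' Z)
  exact (isIso_totalChart Z s).isLocallyRinged

theorem isMorphism_total_symm : IsMorphism (trivialBundle Z fr s).total (Z.prod (glSpace fr s))
    (fun t => (t.1, t.2)) := by
  have := restrict_isLocallyRinged (isOpen_univ' Z)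
  have f := isMorphism_fst (Z.restrict Set.univ) (affineSpace (Fintype.card (GlIndex fr s)))
  have g := isMorphism_snd (Z.restrict Set.univ) (affineSpace (Fintype.card (GlIndex fr s)))
  have h : IsMorphism ((Z.restrict Set.univ).prod (affineSpace (Fintype.card (GlIndex fr s))))
      (glSpace fr s) (fun p => (glTriv fr s).symm p.2) :=
    isMorphism_ofCoords fun i => by
      simp only [glCoords_glTriv_symm]
      exact g.coord _
  have := (((isMorphism_val (isOpen_univ' Z)).comp f).pair h).comp (isIso_totalChart Z s).2
  convert this using 2 with t
  exact Prod.ext rfl ((glTriv fr s).symm_apply_apply t.2).symm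

theorem isMorphism_total : IsMorphism (Z.prod (glSpace fr s)) (trivialBundle Z fr s).total
    (fun p => ⟨p.1, p.2⟩) := by
  have f := isMorphism_fst Z (glSpace fr s)
  have g := isMorphism_snd Z (glSpace fr s)
  have h : IsMorphism (Z.prod (glSpace fr s)) (affineSpace (Fintype.card (GlIndex fr s)))
      (fun p => glTriv fr s p.2) :=
    isMorphism_ofCoords fun i => by
      simp only [glTriv_apply]
      exact g.coord _
  have := (isIso_totalChart (fr := fr) Z s).1.comp
    ((f.codRestrict (U := Set.univ) fun _ => trivial).pair h)
  convert this using 2 with p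
  exact Sigma.ext rfl (heq_of_eq ((glTriv fr s).symm_apply_apply p.2).symm)

/-- The identification of `𝔤𝔩_s^•` with its dual by the pairing. -/
def glDual (fr : Framing) (s : ℕ) (φ : GlType fr s) : Module.Dual ℂ (GlType fr s) :=
  (∑ e, glCoords fr s φ (dualIndex fr s e) • LinearMap.proj e :
    (GlIndex fr s → ℂ) →ₗ[ℂ] ℂ).comp (glCoordsEquiv fr s).toLinearMap

theorem glDual_apply (φ T : GlType fr s) : glDual fr s φ T = glPairing fr s φ T := by
  simp [glDual, glPairing, glCoordsEquiv_apply]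

/-- The element of `𝔤𝔩_s^•` with given coordinates in the basis dual to the standard one. -/
def glOfDualCoords (fr : Framing) (s : ℕ) (c : Fin (Fintype.card (GlIndex fr s)) → ℂ) :
    GlType fr s :=
  (glCoordsEquiv fr s).symm fun i => c (Fintype.equivFin _ ((dualIndex fr s).symm i))

theorem glCoords_glOfDualCoords (c : Fin (Fintype.card (GlIndex fr s)) → ℂ) (i : GlIndex fr s) :
    glCoords fr s (glOfDualCoords fr s c) i = c (Fintype.equivFin _ ((dualIndex fr s).symm i)) := by
  rw [← glCoordsEquiv_apply, glOfDualCoords, LinearEquiv.apply_symm_apply]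

/-- The coordinates of an element of `𝔤𝔩_s^•` in the basis dual to the standard one. -/
def glDualCoords (fr : Framing) (s : ℕ) (φ : GlType fr s) :
    Fin (Fintype.card (GlIndex fr s)) → ℂ :=
  fun e => glCoords fr s φ (dualIndex fr s ((Fintype.equivFin _).symm e))

theorem glOfDualCoords_glDualCoords (φ : GlType fr s) :
    glOfDualCoords fr s (glDualCoords fr s φ) = φ := by
  refine glCoords_injective fr s (funext fun i => ?_)
  simp [glCoords_glOfDualCoords, glDualCoords]

theorem glDualCoords_glOfDualCoords (c : Fin (Fintype.card (GlIndex fr s)) → ℂ) :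
    glDualCoords fr s (glOfDualCoords fr s c) = c := by
  funext e
  simp [glCoords_glOfDualCoords, glDualCoords]

/-- The functionals by which `VectorBundle.double` parametrizes the dual fibres of the trivial bundle
are those of the pairing. -/
theorem dual_of_glDualCoords (φ : GlType fr s) :
    (∑ e, glDualCoords fr s φ e • LinearMap.proj e :
      (Fin (Fintype.card (GlIndex fr s)) → ℂ) →ₗ[ℂ] ℂ).comp (glTriv fr s).toLinearMap =
      glDual fr s φ := by
  ext T
  rw [glDual_apply]
  simp only [LinearMap.comp_apply, LinearEquiv.coe_coe, LinearMap.sum_apply, LinearMap.smul_apply,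
    LinearMap.proj_apply, smul_eq_mul, glPairing, glTriv_apply, glDualCoords]
  exact (Fintype.equivFin (GlIndex fr s)).symm.sum_comp
    fun e => glCoords fr s φ (dualIndex fr s e) * glCoords fr s T e

/-- The pairing is perfect. -/
theorem glDual_bijective : Function.Bijective (glDual fr s) := by
  classical
  constructor
  · intro φ ψ h
    refine glCoords_injective fr s (funext fun i => ?_)
    have := LinearMap.congr_fun h ((glCoordsEquiv fr s).symm (Pi.single ((dualIndex fr s).symm i) 1))
    simp only [glDual_apply, glPairing] at this
    simpa [← glCoordsEquiv_apply, Pi.single_apply] using this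
  · intro ℓ
    let c : GlIndex fr s → ℂ := fun i => ℓ ((glCoordsEquiv fr s).symm (Pi.single i 1))
    refine ⟨(glCoordsEquiv fr s).symm fun i => c ((dualIndex fr s).symm i), ?_⟩
    ext T
    rw [glDual_apply, glPairing]
    obtain ⟨t, rfl⟩ := (glCoordsEquiv fr s).symm.surjective T
    simp only [← glCoordsEquiv_apply, LinearEquiv.apply_symm_apply, Equiv.symm_apply_apply]
    conv_rhs => rw [pi_eq_sum_univ' t]
    simp only [map_sum, map_smul, smul_eq_mul, c]
    refine Finset.sum_congr rfl fun i _ => ?_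
    rw [mul_comm]

theorem glDual_glCoact (a : GLn s) (φ : GlType fr s) :
    glDual fr s (glCoact fr s a φ) = (glDual fr s φ).comp (glActEquiv fr s a).symm.toLinearMap := by
  ext T
  change _ = glDual fr s φ (glAct fr s a⁻¹ T)
  rw [glDual_apply, glDual_apply]
  have := glPairing_glCoact fr s a φ (glAct fr s a⁻¹ T)
  rwa [glAct_glAct_inv] at this

/-- The identification of `𝔤𝔩_s^•` with its dual, as a bijection. -/
def glDualEquiv (fr : Framing) (s : ℕ) : GlType fr s ≃ Module.Dual ℂ (GlType fr s) :=
  Equiv.ofBijective (glDual fr s) (glDual_bijective s)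

/-- The bijection along which `V ×_Z V^*` is glued for the trivial bundle. -/
def doubleChart (Z : Space) [Z.IsLocallyRinged] (fr : Framing) (s : ℕ) :
    (((Z.restrict Set.univ).prod (affineSpace (Fintype.card (GlIndex fr s)))).prod
      (affineSpace (Fintype.card (GlIndex fr s)))).carrier ≃
      (trivialBundle Z fr s).double.carrier where
  toFun p := ⟨p.1.1.1, (glTriv fr s).symm p.1.2, glDualEquiv fr s (glOfDualCoords fr s p.2)⟩
  invFun t := ((⟨t.1, trivial⟩, glTriv fr s t.2.1),
    glDualCoords fr s ((glDualEquiv fr s).symm t.2.2))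
  left_inv p := by simp [glDualCoords_glOfDualCoords]
  right_inv t := by
    refine Sigma.ext rfl (heq_of_eq (Prod.ext ?_ ?_))
    · exact (glTriv fr s).symm_apply_apply t.2.1
    · dsimp only
      rw [glOfDualCoords_glDualCoords]
      exact (glDualEquiv fr s).apply_symm_apply _

theorem isIso_doubleChart :
    IsIso (X := ((Z.restrict Set.univ).prod (affineSpace (Fintype.card (GlIndex fr s)))).prod
      (affineSpace (Fintype.card (GlIndex fr s))))
      (Y := (trivialBundle Z fr s).double) (doubleChart Z fr s) := by
  refine isIso_glue (I := Unit) (M := fun _ : Unit =>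
    ((Z.restrict Set.univ).prod (affineSpace (Fintype.card (GlIndex fr s)))).prod
      (affineSpace (Fintype.card (GlIndex fr s)))) _ fun p => ?_
  refine Sigma.ext rfl (heq_of_eq (Prod.ext rfl ?_))
  have := dual_of_glDualCoords s (glOfDualCoords fr s p.2)
  rw [glDualCoords_glOfDualCoords] at this
  exact this

instance double_isLocallyRinged : (trivialBundle Z fr s).double.IsLocallyRinged := by
  have := restrict_isLocallyRinged (isOpen_univ' Z)
  exact (isIso_doubleChart Z s).isLocallyRinged

theorem isMorphism_double_symm : IsMorphism (trivialBundle Z fr s).double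
    ((Z.prod (glSpace fr s)).prod (glSpace fr s))
    (fun t => ((t.1, t.2.1), (glDualEquiv fr s).symm t.2.2)) := by
  have := restrict_isLocallyRinged (isOpen_univ' Z)
  have f := isMorphism_fst
    ((Z.restrict Set.univ).prod (affineSpace (Fintype.card (GlIndex fr s))))
    (affineSpace (Fintype.card (GlIndex fr s)))
  have g := isMorphism_snd
    ((Z.restrict Set.univ).prod (affineSpace (Fintype.card (GlIndex fr s))))
    (affineSpace (Fintype.card (GlIndex fr s)))
  have h1 : IsMorphism (((Z.restrict Set.univ).prod (affineSpace (Fintype.card (GlIndex fr s)))).prod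
      (affineSpace (Fintype.card (GlIndex fr s)))) (glSpace fr s)
      (fun p => (glTriv fr s).symm p.1.2) :=
    isMorphism_ofCoords fun i => by
      simp only [glCoords_glTriv_symm]
      exact f.snd.coord _
  have h2 : IsMorphism (((Z.restrict Set.univ).prod (affineSpace (Fintype.card (GlIndex fr s)))).prod
      (affineSpace (Fintype.card (GlIndex fr s)))) (glSpace fr s)
      (fun p => glOfDualCoords fr s p.2) :=
    isMorphism_ofCoords fun i => by
      simp only [glCoords_glOfDualCoords]
      exact g.coord _
  have := ((((isMorphism_val (isOpen_univ' Z)).comp f.fst).pair h1).pair h2).comp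
    (isIso_doubleChart Z s).2
  convert this using 2 with t
  refine Prod.ext (Prod.ext rfl ((glTriv fr s).symm_apply_apply t.2.1).symm) ?_
  exact (glOfDualCoords_glDualCoords s _).symm

theorem isMorphism_double : IsMorphism ((Z.prod (glSpace fr s)).prod (glSpace fr s))
    (trivialBundle Z fr s).double (fun p => ⟨p.1.1, p.1.2, glDualEquiv fr s p.2⟩) := by
  have f := isMorphism_fst (Z.prod (glSpace fr s)) (glSpace fr s)
  have g := isMorphism_snd (Z.prod (glSpace fr s)) (glSpace fr s)
  have h1 : IsMorphism ((Z.prod (glSpace fr s)).prod (glSpace fr s))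
      (affineSpace (Fintype.card (GlIndex fr s))) (fun p => glTriv fr s p.1.2) :=
    isMorphism_ofCoords fun i => by
      simp only [glTriv_apply]
      exact f.snd.coord _
  have h2 : IsMorphism ((Z.prod (glSpace fr s)).prod (glSpace fr s))
      (affineSpace (Fintype.card (GlIndex fr s))) (fun p => glDualCoords fr s p.2) :=
    isMorphism_ofCoords fun i => g.coord _
  have := (isIso_doubleChart (fr := fr) Z s).1.comp
    (((f.fst.codRestrict (U := Set.univ) fun _ => trivial).pair h1).pair h2)
  convert this using 2 with p
  refine Sigma.ext rfl (heq_of_eq (Prod.ext ((glTriv fr s).symm_apply_apply p.1.2).symm ?_))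
  exact congrArg (glDualEquiv fr s) (glOfDualCoords_glDualCoords s p.2).symm

end TrivialBundle

/-! ### Elimination of a pair of dual variables -/

/-- A potential `P(X, z, y, Y)` on `𝔤𝔩_n^• × Z × 𝔤𝔩_m^• × 𝔤𝔩_s^•`, where `GL_n × GL_m` acts
on `𝔤𝔩_s^•` through a homomorphism to `GL_s`, together with an equivariant change of coordinates
`T = τ(X, y, Y)`, `Y = υ(X, y, T)`, such that `P` restricts to the potential of `L` on the locus
`T = 0`. -/
structure DualPairData (L : HomObj fr n m) where
  s : ℕ
  toGL : GLn n × GLn m →* GLn s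
  isMorphism_toGL : IsMorphism (groupSpace n m) (glnSpace s) toGL
  τ : GlType fr n → GlType fr m → GlType fr s → GlType fr s
  υ : GlType fr n → GlType fr m → GlType fr s → GlType fr s
  τ_υ : ∀ X y T, τ X y (υ X y T) = T
  υ_τ : ∀ X y Y, υ X y (τ X y Y) = Y
  isMorphism_τ : IsMorphism (((glSpace fr n).prod (glSpace fr m)).prod (glSpace fr s))
    (glSpace fr s) (fun q => τ q.1.1 q.1.2 q.2)
  isMorphism_υ : IsMorphism (((glSpace fr n).prod (glSpace fr m)).prod (glSpace fr s))
    (glSpace fr s) (fun q => υ q.1.1 q.1.2 q.2)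
  τ_equivariant : ∀ a b X y Y, τ (glAct fr n a X) (glAct fr m b y) (glAct fr s (toGL (a, b)) Y) =
    glAct fr s (toGL (a, b)) (τ X y Y)
  P : GlType fr n → L.Z.carrier → GlType fr m → GlType fr s → ℂ
  regular_P : ((((glSpace fr n).prod L.Z).prod (glSpace fr m)).prod (glSpace fr s)).Regular
    (fun q => P q.1.1.1 q.1.1.2 q.1.2 q.2)
  P_invariant : ∀ a b X z y Y, P (glAct fr n a X) ((a, b) • z) (glAct fr m b y)
    (glAct fr s (toGL (a, b)) Y) = P X z y Y
  P_zero : ∀ X z y, P X z y (υ X y 0) = L.w X z y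

namespace DualPairData

variable {L : HomObj fr n m} (D : DualPairData L)

theorem υ_equivariant (a : GLn n) (b : GLn m) (X : GlType fr n) (y : GlType fr m)
    (T : GlType fr D.s) :
    D.υ (glAct fr n a X) (glAct fr m b y) (glAct fr D.s (D.toGL (a, b)) T) =
      glAct fr D.s (D.toGL (a, b)) (D.υ X y T) := by
  have := D.τ_equivariant a b X y (D.υ X y T)
  rw [D.τ_υ] at this
  rw [← this, D.υ_τ]

/-- The diagonal action on `(𝔤𝔩_s^•)^* × 𝔤𝔩_s^• × Z`. -/
abbrev action :
    MulAction (GLn n × GLn m) ((GlType fr D.s × GlType fr D.s) × L.Z.carrier) where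
  smul g q := ((glCoact fr D.s (D.toGL g) q.1.1, glAct fr D.s (D.toGL g) q.1.2), g • q.2)
  one_smul q := by
    change ((glCoact fr D.s (D.toGL 1) q.1.1, glAct fr D.s (D.toGL 1) q.1.2),
      (1 : GLn n × GLn m) • q.2) = q
    rw [map_one, glCoact_one, glAct_one, one_smul]
  mul_smul g h q := by
    change ((glCoact fr D.s (D.toGL (g * h)) q.1.1, glAct fr D.s (D.toGL (g * h)) q.1.2),
        (g * h) • q.2) =
      ((glCoact fr D.s (D.toGL g) (glCoact fr D.s (D.toGL h) q.1.1),
        glAct fr D.s (D.toGL g) (glAct fr D.s (D.toGL h) q.1.2)), g • h • q.2)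
    rw [map_mul, glCoact_mul, glAct_mul, mul_smul]

/-- The object `((𝔤𝔩_s^•)^* × 𝔤𝔩_s^• × Z, P(X, z, y, Y) + ⟨φ, τ(X, y, Y)⟩)`, with points
`((φ, Y), z)`. -/
def double : HomObj fr n m where
  Z := ((glSpace fr D.s).prod (glSpace fr D.s)).prod L.Z
  isVariety := ((glSpace_isVariety fr D.s).prod (glSpace_isVariety fr D.s)).prod L.isVariety
  act := D.action
  act_algebraic := by
    have f := isMorphism_fst (groupSpace n m)
      (((glSpace fr D.s).prod (glSpace fr D.s)).prod L.Z)
    have g := isMorphism_snd (groupSpace n m)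
      (((glSpace fr D.s).prod (glSpace fr D.s)).prod L.Z)
    have h := D.isMorphism_toGL.comp f
    exact ((h.glCoact g.fst.fst).pair (h.glAct g.fst.snd)).pair
      (L.act_algebraic.comp (f.pair g.snd))
  w X q y := D.P X q.2 y q.1.2 + glPairing fr D.s q.1.1 (D.τ X y q.1.2)
  w_regular := by
    have f := isMorphism_fst ((glSpace fr n).prod
      (((glSpace fr D.s).prod (glSpace fr D.s)).prod L.Z)) (glSpace fr m)
    have y := isMorphism_snd ((glSpace fr n).prod
      (((glSpace fr D.s).prod (glSpace fr D.s)).prod L.Z)) (glSpace fr m)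
    have X := f.fst
    have z := f.snd.snd
    have φ := f.snd.fst.fst
    have Y := f.snd.fst.snd
    have h1 := (((X.pair z).pair y).pair Y).regular_comp D.regular_P
    have h2 := φ.glPairing (D.isMorphism_τ.comp ((X.pair y).pair Y))
    exact fun x => regAt_add (h1 x) (h2 x)
  w_invariant a b X q y := by
    refine congrArg₂ (· + ·) (D.P_invariant a b X q.2 y q.1.2) ?_
    refine Eq.trans (congrArg _ (D.τ_equivariant a b X y q.1.2)) ?_
    exact glPairing_glCoact _ _ _ _ _

/-- The trivial bundle with fibre `𝔤𝔩_s^•`. -/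
def bundle : EquivBundle L where
  toVectorBundle := trivialBundle L.Z fr D.s
  act g _ := glActEquiv fr D.s (D.toGL g)
  act_one z v := by
    refine Sigma.ext (one_smul _ z) (heq_of_eq ?_)
    exact (congrArg (fun a => glAct fr D.s a v) (map_one D.toGL)).trans (glAct_one fr D.s v)
  act_mul g h z v := by
    refine Sigma.ext (mul_smul g h z) (heq_of_eq ?_)
    exact (congrArg (fun a => glAct fr D.s a v) (map_mul D.toGL g h)).trans
      (glAct_mul fr D.s _ _ v)
  act_algebraic := by
    have f := isMorphism_fst (groupSpace n m) (trivialBundle L.Z fr D.s).total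
    have g := (isMorphism_total_symm (fr := fr) L.Z D.s).comp
      (isMorphism_snd (groupSpace n m) (trivialBundle L.Z fr D.s).total)
    exact (isMorphism_total L.Z D.s).comp ((L.act_algebraic.comp (f.pair g.fst)).pair
      ((D.isMorphism_toGL.comp f).glAct g.snd))

/-- The identification of `𝔤𝔩_n^• × (𝔤𝔩_s^•)^* × 𝔤𝔩_s^• × Z × 𝔤𝔩_m^•` with
`𝔤𝔩_n^• × (V ×_Z V^*) × 𝔤𝔩_m^•` by the change of coordinates `T = τ(X, y, Y)`. -/
def doubleEquiv : (((glSpace fr n).prod D.double.Z).prod (glSpace fr m)).carrier ≃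
    (((glSpace fr n).prod (trivialBundle L.Z fr D.s).double).prod (glSpace fr m)).carrier where
  toFun p := ((p.1.1, ⟨p.1.2.2, D.τ p.1.1 p.2 p.1.2.1.2, glDualEquiv fr D.s p.1.2.1.1⟩), p.2)
  invFun p := ((p.1.1, (((glDualEquiv fr D.s).symm p.1.2.2.2, D.υ p.1.1 p.2 p.1.2.2.1), p.1.2.1)),
    p.2)
  left_inv := by
    rintro ⟨⟨X, ⟨φ, Y⟩, z⟩, y⟩
    dsimp only
    rw [D.υ_τ, Equiv.symm_apply_apply]
  right_inv := by
    rintro ⟨⟨X, z, T, ℓ⟩, y⟩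
    refine Prod.ext (Prod.ext rfl (Sigma.ext rfl (heq_of_eq (Prod.ext ?_ ?_)))) rfl
    · exact D.τ_υ X y T
    · exact (glDualEquiv fr D.s).apply_symm_apply ℓ

theorem isIso_doubleEquiv : IsIso (X := ((glSpace fr n).prod D.double.Z).prod (glSpace fr m))
    (Y := ((glSpace fr n).prod (trivialBundle L.Z fr D.s).double).prod (glSpace fr m))
    D.doubleEquiv := by
  constructor
  · have f := isMorphism_fst ((glSpace fr n).prod
      (((glSpace fr D.s).prod (glSpace fr D.s)).prod L.Z)) (glSpace fr m)
    have y := isMorphism_snd ((glSpace fr n).prod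
      (((glSpace fr D.s).prod (glSpace fr D.s)).prod L.Z)) (glSpace fr m)
    exact (f.fst.pair ((isMorphism_double L.Z D.s).comp ((f.snd.snd.pair
      (D.isMorphism_τ.comp ((f.fst.pair y).pair f.snd.fst.snd))).pair f.snd.fst.fst))).pair y
  · have f := isMorphism_fst ((glSpace fr n).prod (trivialBundle L.Z fr D.s).double) (glSpace fr m)
    have y := isMorphism_snd ((glSpace fr n).prod (trivialBundle L.Z fr D.s).double) (glSpace fr m)
    have t := (isMorphism_double_symm (fr := fr) L.Z D.s).comp f.snd
    exact (f.fst.pair ((t.snd.pair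
      (D.isMorphism_υ.comp ((f.fst.pair y).pair t.fst.snd))).pair t.fst.fst)).pair y

/-- Linearity of the second summand in `T = τ(X, y, Y)` makes it the canonical pairing of the trivial
bundle. -/
theorem knorrerStep : KnorrerStep L D.double := by
  refine ⟨D.bundle, fun X t y => D.P X t.1 y (D.υ X y t.2), D.doubleEquiv, ?_, ?_, D.P_zero,
    D.isIso_doubleEquiv, fun _ _ _ => ⟨rfl, rfl⟩, ?_, ?_⟩
  · have f := isMorphism_fst ((glSpace fr n).prod (trivialBundle L.Z fr D.s).total) (glSpace fr m)
    have y := isMorphism_snd ((glSpace fr n).prod (trivialBundle L.Z fr D.s).total) (glSpace fr m)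
    have t := (isMorphism_total_symm (fr := fr) L.Z D.s).comp f.snd
    exact (((f.fst.pair t.fst).pair y).pair
      (D.isMorphism_υ.comp ((f.fst.pair y).pair t.snd))).regular_comp D.regular_P
  · intro a b X t y
    refine Eq.trans (congrArg _ (D.υ_equivariant a b X y t.2)) ?_
    exact D.P_invariant a b X t.1 y _
  · rintro a b X ⟨⟨φ, Y⟩, z⟩ y
    refine Sigma.ext rfl (heq_of_eq (Prod.ext ?_ ?_))
    · exact D.τ_equivariant a b X y Y
    · exact glDual_glCoact D.s (D.toGL (a, b)) φ
  · rintro X ⟨⟨φ, Y⟩, z⟩ y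
    refine congrArg₂ (· + ·) ?_ (glDual_apply D.s φ (D.τ X y Y)).symm
    exact congrArg _ (D.υ_τ X y Y).symm

end DualPairData

/-- If the composition is the object of a dual pair over `L`, it exists and is equivalent to `L`. -/
theorem exists_isComposition_and_knorrerEquiv {k : ℕ} {L : HomObj fr n m} (D : DualPairData L)
    {L₁ : HomObj fr n k} {L₂ : HomObj fr k m} (h : IsComposition L₁ L₂ D.double ∧
      ∀ K, IsComposition L₁ L₂ K → ∃ e, D.double.IsIsoTo K e) :
    (∃ K, IsComposition L₁ L₂ K) ∧ ∀ K, IsComposition L₁ L₂ K → KnorrerEquiv K L := by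
  refine ⟨⟨_, h.1⟩, fun K hK => ?_⟩
  obtain ⟨e, he⟩ := h.2 K hK
  exact (Relation.EqvGen.rel _ _ (D.knorrerStep.trans_iso he)).symm

/-! ### Composition with the identity along `𝔤𝔩_n^•` -/

/-- The dual pair `T = X - Y`, with potential `w(Y, z, y)`. -/
def leftData (L : HomObj fr n m) : DualPairData L where
  s := n
  toGL := MonoidHom.fst _ _
  isMorphism_toGL := isMorphism_groupSpace_fst
  τ X _ Y := X - Y
  υ X _ T := X - T
  τ_υ _ _ _ := sub_sub_cancel _ _
  υ_τ _ _ _ := sub_sub_cancel _ _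
  isMorphism_τ :=
    have f := isMorphism_fst ((glSpace fr n).prod (glSpace fr m)) (glSpace fr n)
    f.fst.sub (isMorphism_snd _ _)
  isMorphism_υ :=
    have f := isMorphism_fst ((glSpace fr n).prod (glSpace fr m)) (glSpace fr n)
    f.fst.sub (isMorphism_snd _ _)
  τ_equivariant a _ X _ Y := (glAct_sub fr n a X Y).symm
  P _ z y Y := L.w Y z y
  regular_P :=
    have f := isMorphism_fst (((glSpace fr n).prod L.Z).prod (glSpace fr m)) (glSpace fr n)
    L.regular_w (isMorphism_snd _ _) f.fst.snd f.snd
  P_invariant a b _ z y Y := L.w_invariant a b Y z y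
  P_zero _ _ _ := by rw [sub_zero]

/-- The quotient map is `((g, φ), Y, z) ↦ (φ, Ad_g Y, (g, 1) · z)`, with section given by `g = 1`. -/
theorem left_isComposition (L : HomObj fr n m) :
    IsComposition (idObj fr n) L (leftData L).double ∧
      ∀ K, IsComposition (idObj fr n) L K → ∃ e, (leftData L).double.IsIsoTo K e := by
  have f := isMorphism_fst ((idObj fr n).Z.prod (glSpace fr n)) L.Z
  have z := isMorphism_snd ((idObj fr n).Z.prod (glSpace fr n)) L.Z
  have g := f.fst.idGroup
  refine isComposition_of_section
    (π := fun p => ((idFibre fr n p.1.1, glAct fr n (idGroup fr n p.1.1) p.1.2),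
      (idGroup fr n p.1.1, (1 : GLn m)) • p.2))
    (s := fun q => ((idMk fr n 1 q.1.1, q.1.2), q.2)) ?_ ?_ ?_ ?_ ?_ ?_ ?_
  · -- The function `det g⁻¹` is semi-invariant and vanishes nowhere.
    intro x
    refine ⟨1, fun p => (idGroup fr n p.1.1)⁻¹.1.det, one_pos,
      regular_det (isMorphism_glnSpace_iff.1 g).2, ?_,
      ((Matrix.isUnit_iff_isUnit_det _).1 (idGroup fr n x.1.1)⁻¹.isUnit).ne_zero⟩
    rintro b ⟨⟨x, Y⟩, z⟩
    rw [← idMk_eta x]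
    simp only [midAct, idObj_smul, idGroup_idMk, one_mul, mul_inv_rev, inv_inv, Units.val_mul,
      Matrix.det_mul, pow_one]
  · exact (f.fst.idFibre.pair (g.glAct f.snd)).pair
      (L.isMorphism_smul g (IsMorphism.const _ (glnSpace m) 1) z)
  · have q := isMorphism_fst ((glSpace fr n).prod (glSpace fr n)) L.Z
    have z := isMorphism_snd ((glSpace fr n).prod (glSpace fr n)) L.Z
    exact (((IsMorphism.const _ (glnSpace n) 1).idMk q.fst).pair q.snd).pair z
  · rintro ⟨⟨(φ : GlType fr n), (Y : GlType fr n)⟩, z⟩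
    dsimp only
    rw [idFibre_idMk, idGroup_idMk, glAct_one, Prod.mk_one_one, one_smul]
  · rintro ⟨⟨x, Y⟩, z⟩ p
    rw [← idMk_eta x]
    generalize idGroup fr n x = g, idFibre fr n x = φ
    constructor
    · rintro ⟨b, rfl⟩
      simp only [midAct, idObj_smul, idGroup_idMk, idFibre_idMk, one_mul, glCoact_one]
      refine Prod.ext (Prod.ext rfl ?_) ?_
      · change glAct fr n g Y = glAct fr n (g * b⁻¹) (glAct fr n b Y)
        rw [← glAct_mul, inv_mul_cancel_right]
      · change (g, (1 : GLn m)) • z = (g * b⁻¹, (1 : GLn m)) • (b, (1 : GLn m)) • z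
        rw [smul_smul, Prod.mk_mul_mk, inv_mul_cancel_right, one_mul]
    · obtain ⟨⟨x', Y'⟩, z'⟩ := p
      rw [← idMk_eta x']
      generalize idGroup fr n x' = g', idFibre fr n x' = φ'
      simp only [idGroup_idMk, idFibre_idMk]
      intro h
      have h1 : φ = φ' := congrArg (fun q => q.1.1) h
      have h2 : glAct fr n g Y = glAct fr n g' Y' := congrArg (fun q => q.1.2) h
      have h3 : (g, (1 : GLn m)) • z = (g', (1 : GLn m)) • z' := congrArg (fun q => q.2) h
      refine ⟨g'⁻¹ * g, Prod.ext (Prod.ext ?_ ?_) ?_⟩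
      · change idMk fr n g' φ' = ((1 : GLn n), g'⁻¹ * g) • idMk fr n g φ
        rw [idObj_smul, glCoact_one, h1, mul_inv_rev, inv_inv, one_mul, mul_inv_cancel_left]
      · change Y' = glAct fr n (g'⁻¹ * g) Y
        rw [glAct_mul, h2, glAct_inv_glAct]
      · change z' = (g'⁻¹ * g, (1 : GLn m)) • z
        have : ((g'⁻¹ * g, 1) : GLn n × GLn m) = (g', 1)⁻¹ * (g, 1) := by simp
        rw [this, mul_smul, h3, inv_smul_smul]
  · rintro a c ⟨⟨x, Y⟩, z⟩
    rw [← idMk_eta x]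
    simp only [outAct, idObj_smul, idGroup_idMk, idFibre_idMk, inv_one, mul_one]
    refine Prod.ext (Prod.ext rfl ?_) ?_
    · exact glAct_mul fr n a _ Y
    · change (a * idGroup fr n x, (1 : GLn m)) • ((1 : GLn n), c) • z =
        (a, c) • (idGroup fr n x, (1 : GLn m)) • z
      rw [smul_smul, smul_smul, Prod.mk_mul_mk, Prod.mk_mul_mk]
      simp
  · rintro X ⟨⟨x, Y⟩, z⟩ y
    rw [idObj_w, add_comm]
    refine congrArg₂ (· + ·) ?_ rfl
    have := L.w_invariant (idGroup fr n x) 1 Y z y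
    rwa [glAct_one] at this

/-! ### Composition with the identity along `𝔤𝔩_m^•` -/

/-- The dual pair `T = Y - y`, with potential `w(X, z, Y)`. -/
def rightData (L : HomObj fr n m) : DualPairData L where
  s := m
  toGL := MonoidHom.snd _ _
  isMorphism_toGL := isMorphism_groupSpace_snd
  τ _ y Y := Y - y
  υ _ y T := T + y
  τ_υ _ _ _ := add_sub_cancel_right _ _
  υ_τ _ _ _ := sub_add_cancel _ _
  isMorphism_τ :=
    have f := isMorphism_fst ((glSpace fr n).prod (glSpace fr m)) (glSpace fr m)
    IsMorphism.sub (isMorphism_snd _ _) f.snd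
  isMorphism_υ :=
    have f := isMorphism_fst ((glSpace fr n).prod (glSpace fr m)) (glSpace fr m)
    IsMorphism.add (isMorphism_snd _ _) f.snd
  τ_equivariant _ b _ y Y := (glAct_sub fr m b Y y).symm
  P X z _ Y := L.w X z Y
  regular_P :=
    have f := isMorphism_fst (((glSpace fr n).prod L.Z).prod (glSpace fr m)) (glSpace fr m)
    L.regular_w f.fst.fst f.fst.snd (isMorphism_snd _ _)
  P_invariant a b X z _ Y := L.w_invariant a b X z Y
  P_zero _ _ _ := by rw [zero_add]

/-- The quotient map is `(z, Y, (g, φ)) ↦ (Ad_{g⁻¹} φ, Ad_{g⁻¹} Y, (1, g⁻¹) · z)`, with section given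
by `g = 1`. -/
theorem right_isComposition (L : HomObj fr n m) :
    IsComposition L (idObj fr m) (rightData L).double ∧
      ∀ K, IsComposition L (idObj fr m) K → ∃ e, (rightData L).double.IsIsoTo K e := by
  have f := isMorphism_fst (L.Z.prod (glSpace fr m)) (idObj fr m).Z
  have x := isMorphism_snd (L.Z.prod (glSpace fr m)) (idObj fr m).Z
  have g := x.idGroup
  refine isComposition_of_section
    (π := fun p => ((glCoact fr m (idGroup fr m p.2)⁻¹ (idFibre fr m p.2),
      glAct fr m (idGroup fr m p.2)⁻¹ p.1.2), ((1 : GLn n), (idGroup fr m p.2)⁻¹) • p.1.1))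
    (s := fun q => ((q.2, q.1.2), idMk fr m 1 q.1.1)) ?_ ?_ ?_ ?_ ?_ ?_ ?_
  · -- The function `det g` is semi-invariant and vanishes nowhere.
    intro x
    refine ⟨1, fun p => (idGroup fr m p.2).1.det, one_pos,
      regular_det (isMorphism_glnSpace_iff.1 g).1, ?_,
      ((Matrix.isUnit_iff_isUnit_det _).1 (idGroup fr m x.2).isUnit).ne_zero⟩
    rintro b ⟨⟨z, Y⟩, x⟩
    rw [← idMk_eta x]
    simp only [midAct, idObj_smul, idGroup_idMk, inv_one, mul_one, Units.val_mul,
      Matrix.det_mul, pow_one]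
  · exact ((g.inv_gln.glCoact x.idFibre).pair (g.inv_gln.glAct f.snd)).pair
      (L.isMorphism_smul (IsMorphism.const _ (glnSpace n) 1) g.inv_gln f.fst)
  · have q := isMorphism_fst ((glSpace fr m).prod (glSpace fr m)) L.Z
    have z := isMorphism_snd ((glSpace fr m).prod (glSpace fr m)) L.Z
    exact (z.pair q.snd).pair ((IsMorphism.const _ (glnSpace m) 1).idMk q.fst)
  · rintro ⟨⟨(φ : GlType fr m), (Y : GlType fr m)⟩, z⟩
    dsimp only
    rw [idFibre_idMk, idGroup_idMk, inv_one, glAct_one, glCoact_one, Prod.mk_one_one, one_smul]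
  · rintro ⟨⟨z, Y⟩, x⟩ p
    rw [← idMk_eta x]
    generalize idGroup fr m x = g, idFibre fr m x = φ
    constructor
    · rintro ⟨b, rfl⟩
      simp only [midAct, idObj_smul, idGroup_idMk, idFibre_idMk, inv_one, mul_one]
      refine Prod.ext (Prod.ext ?_ ?_) ?_
      · change glCoact fr m g⁻¹ φ = glCoact fr m (b * g)⁻¹ (glCoact fr m b φ)
        rw [← glCoact_mul, mul_inv_rev, inv_mul_cancel_right]
      · change glAct fr m g⁻¹ Y = glAct fr m (b * g)⁻¹ (glAct fr m b Y)
        rw [← glAct_mul, mul_inv_rev, inv_mul_cancel_right]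
      · change ((1 : GLn n), g⁻¹) • z = ((1 : GLn n), (b * g)⁻¹) • ((1 : GLn n), b) • z
        rw [smul_smul, Prod.mk_mul_mk, mul_inv_rev, inv_mul_cancel_right, one_mul]
    · obtain ⟨⟨z', Y'⟩, x'⟩ := p
      rw [← idMk_eta x']
      generalize idGroup fr m x' = g', idFibre fr m x' = φ'
      simp only [idGroup_idMk, idFibre_idMk]
      intro h
      have h1 : glCoact fr m g⁻¹ φ = glCoact fr m g'⁻¹ φ' := congrArg (fun q => q.1.1) h
      have h2 : glAct fr m g⁻¹ Y = glAct fr m g'⁻¹ Y' := congrArg (fun q => q.1.2) h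
      have h3 : ((1 : GLn n), g⁻¹) • z = ((1 : GLn n), g'⁻¹) • z' := congrArg (fun q => q.2) h
      refine ⟨g' * g⁻¹, Prod.ext (Prod.ext ?_ ?_) ?_⟩
      · change z' = ((1 : GLn n), g' * g⁻¹) • z
        have : ((1, g' * g⁻¹) : GLn n × GLn m) = (1, g'⁻¹)⁻¹ * (1, g⁻¹) := by simp
        rw [this, mul_smul, h3, inv_smul_smul]
      · change Y' = glAct fr m (g' * g⁻¹) Y
        rw [glAct_mul, h2, glAct_glAct_inv]
      · change idMk fr m g' φ' = (g' * g⁻¹, (1 : GLn m)) • idMk fr m g φ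
        rw [idObj_smul, glCoact_mul, h1, ← glCoact_mul, mul_inv_cancel, glCoact_one, inv_one,
          mul_one, inv_mul_cancel_right]
  · rintro a c ⟨⟨z, Y⟩, x⟩
    rw [← idMk_eta x]
    simp only [outAct, idObj_smul, idGroup_idMk, idFibre_idMk, one_mul, glCoact_one, mul_inv_rev,
      inv_inv]
    refine Prod.ext (Prod.ext ?_ ?_) ?_
    · exact glCoact_mul fr m c _ _
    · exact glAct_mul fr m c _ Y
    · change ((1 : GLn n), c * (idGroup fr m x)⁻¹) • (a, (1 : GLn m)) • z =
        (a, c) • ((1 : GLn n), (idGroup fr m x)⁻¹) • z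
      rw [smul_smul, smul_smul, Prod.mk_mul_mk, Prod.mk_mul_mk]
      simp
  · rintro X ⟨⟨z, Y⟩, x⟩ y
    rw [idObj_w]
    refine congrArg₂ (· + ·) ?_ ?_
    · have := L.w_invariant 1 (idGroup fr m x)⁻¹ X z Y
      rwa [glAct_one] at this
    · have := glPairing_glCoact fr m (idGroup fr m x)⁻¹ (idFibre fr m x)
        (Y - glAct fr m (idGroup fr m x) y)
      rwa [glAct_sub, glAct_inv_glAct] at this

end

end KRS

theorem mainTheorem6 (fr : KRS.Framing) (n m : ℕ) (L : KRS.HomObj fr n m) :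
    ((∃ K : KRS.HomObj fr n m, KRS.IsComposition (KRS.idObj fr n) L K) ∧
      ∀ K : KRS.HomObj fr n m, KRS.IsComposition (KRS.idObj fr n) L K → KRS.KnorrerEquiv K L) ∧
    ((∃ K : KRS.HomObj fr n m, KRS.IsComposition L (KRS.idObj fr m) K) ∧
      ∀ K : KRS.HomObj fr n m, KRS.IsComposition L (KRS.idObj fr m) K → KRS.KnorrerEquiv K L) :=
  ⟨KRS.exists_isComposition_and_knorrerEquiv (KRS.leftData L) (KRS.left_isComposition L),
    KRS.exists_isComposition_and_knorrerEquiv (KRS.rightData L) (KRS.right_isComposition L)⟩
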